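/- For $s,t,u\in\mathbb{C}$ let $$T(s,t,u)=\sum_{m,n=1}^{\infty}\frac{1}{m^{s}n^{t}(m+n)^{u}}$$ be the Tornheim double zeta function, where the series converges absolutely for $\Re(s+u)>1$, $\Re(t+u)>1$, $\Re(s+t+u)>2$. Then the function $s\mapsto T(s,s,s)$, given by the absolutely convergent series $\sum_{m,n\ge1}(m\,n\,(m+n))^{-s}$ for $\Re s>2/3$, has a meromorphic continuation to $\mathbb{C}$. The restriction to the diagonal $s=t=u$ of any analytic continuation of $T(s,t,u)$ to the complement in $\mathbb{C}^3$ of the hyperplanes $s+u=k$, $t+u=k$ ($k\in\mathbb{Z}_{\le 1}$) and $s+t+u=2$ is this same meromorphic function. All the poles of the meromorphic function $T(s,s,s)$ on $\mathbb{C}$ are simple, and they lie exactly at $s=2/3$ and at $s=1/2-k$ for $k\in\mathbb{Z}_{\ge0}$; every one of these points is a pole. -/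

import Mathlib

namespace Tornheim

/-- The term `1 / (m ^ s * n ^ t * (m + n) ^ u)` of the Tornheim double series. -/
noncomputable def term (s t u : ℂ) (p : ℕ+ × ℕ+) : ℂ :=
  1 / (((p.1 : ℕ) : ℂ) ^ s * ((p.2 : ℕ) : ℂ) ^ t * (((p.1 : ℕ) : ℂ) + ((p.2 : ℕ) : ℂ)) ^ u)

/-- The region of absolute convergence of the Tornheim double series. -/
def convergenceRegion : Set (ℂ × ℂ × ℂ) :=
  {x | 1 < (x.1 + x.2.2).re ∧ 1 < (x.2.1 + x.2.2).re ∧ 2 < (x.1 + x.2.1 + x.2.2).re}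

/-- The union of the hyperplanes `s + u = k`, `t + u = k` (with `k ≤ 1` an integer) and
`s + t + u = 2`. -/
def singularSet : Set (ℂ × ℂ × ℂ) :=
  {x | (∃ k : ℤ, k ≤ 1 ∧ x.1 + x.2.2 = k) ∨ (∃ k : ℤ, k ≤ 1 ∧ x.2.1 + x.2.2 = k) ∨
    x.1 + x.2.1 + x.2.2 = 2}

/-- `T` is the Tornheim double zeta function of three variables: it is the sum of the (absolutely
convergent) double series in the region of convergence, and is analytic off the singular
hyperplanes. Its values on the singular hyperplanes are irrelevant. -/
structure IsTornheimZeta (T : ℂ × ℂ × ℂ → ℂ) : Prop where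
  hasSum : ∀ s t u : ℂ, (s, t, u) ∈ convergenceRegion → HasSum (term s t u) (T (s, t, u))
  analytic : AnalyticOnNhd ℂ T singularSetᶜ

/-- `F` is the function `s ↦ T(s, s, s)`: it is meromorphic on `ℂ`, and is the sum of the
(absolutely convergent) double series wherever `(s, s, s)` lies in the region of convergence. -/
structure IsDiagonalTornheimZeta (F : ℂ → ℂ) : Prop where
  hasSum : ∀ s : ℂ, (s, s, s) ∈ convergenceRegion → HasSum (term s s s) (F s)
  meromorphic : ∀ s : ℂ, MeromorphicAt F s

/-- `F` has a pole at `z`. -/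
def IsPole (F : ℂ → ℂ) (z : ℂ) : Prop :=
  MeromorphicAt F z ∧ meromorphicOrderAt F z < 0

/-- `F` has a pole of order exactly one at `z`. -/
def IsSimplePole (F : ℂ → ℂ) (z : ℂ) : Prop :=
  MeromorphicAt F z ∧ meromorphicOrderAt F z = -1

end Tornheim

open Filter Topology MeasureTheory Set

namespace Tornheim

/-! ### Holomorphic dependence of integrals on a parameter -/

/-! Write L_s(x) = ∑ n^(-s) e^(-nx). Expanding the square and integrating termwise gives Γ(s)
T(s,s,s) = ∫_0^∞ x^(s-1) L_s(x)^2 dx for Re s > 2/3 (`Gamma_mul_diagSum`). The part over x > 1 is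
entire, so all poles come from the behaviour of L_s at 0.

For Re s < 1, L_s(x) = Γ(1-s) x^(s-1) + R_s(x), where R_s has the Taylor expansion ∑ a_j(s) x^j with
a_j(s) = (-1)^j ζ(s-j)/j!. This rests on two facts. Poisson summation bounds R_s uniformly in x > 0
when Re s < 0 (`expRem_eq_tsum`). The relation R_s' = -R_(s-1) then carries the bound to Re s < 1 by
integration and, iterated, yields the Taylor remainders (`exists_norm_taylorRem_le`). All estimates
are locally uniform in s, so the remainder integrals are holomorphic.

Squaring and integrating over (0, 1] produces the polar terms Γ(1-s)^2/(3s-2), 2Γ(1-s)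
a_j(s)/(2s-1+j) and a_i(s) a_j(s)/(s+i+j). On division by Γ(s), the poles at nonpositive integers
cancel: the whole third family, and the second for odd j. What is left is 2/3 and, from j = 2k, the
points 1/2 - k, where the residue is a nonzero multiple of ζ(1/2 - 3k). For k ≥ 1 this value is
nonzero by the functional equation; for k = 0, comparing a sum with an integral shows it is negative
(`expansionResidue_ne_zero_iff`).

For the three-variable function, the singular hyperplanes meet the diagonal in a countable set,
whose complement is connected, so the identity theorem applies. -/

theorem differentiableOn_integral_of_dominated {α : Type*} [MeasurableSpace α] {μ : Measure α}
    {F : ℂ → α → ℂ} {U : Set ℂ} (hU : IsOpen U)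
    (hmeas : ∀ s ∈ U, AEStronglyMeasurable (F s) μ)
    (hdiff : ∀ᵐ x ∂μ, DifferentiableOn ℂ (fun s => F s x) U)
    (hbound : ∀ K ⊆ U, IsCompact K → ∃ g : α → ℝ, Integrable g μ ∧
      ∀ᵐ x ∂μ, ∀ s ∈ K, ‖F s x‖ ≤ g x) :
    DifferentiableOn ℂ (fun s => ∫ x, F s x ∂μ) U := by
  intro s₀ hs₀
  obtain ⟨R, hR, hRU⟩ := Metric.isOpen_iff.1 hU s₀ hs₀
  -- Discs of radius `r` about points of `ball s₀ r` stay in the compact ball of radius `2 * r`,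
  -- where the domination holds; Cauchy's estimate then bounds the derivative by `g x / r`.
  set r := R / 4 with hr
  have hr0 : 0 < r := by positivity
  have hKU : Metric.closedBall s₀ (2 * r) ⊆ U := by
    refine Subset.trans (fun z hz => ?_) hRU
    rw [Metric.mem_closedBall] at hz
    rw [Metric.mem_ball]
    linarith
  obtain ⟨g, hg, hFg⟩ := hbound _ hKU (isCompact_closedBall _ _)
  have hball : Metric.ball s₀ r ⊆ U := fun z hz => hKU (by
    rw [Metric.mem_ball] at hz
    rw [Metric.mem_closedBall]
    linarith)
  have hderiv : ∀ᵐ x ∂μ, HasDerivAt (fun s => F s x) (deriv (fun s => F s x) s₀) s₀ := by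
    filter_upwards [hdiff] with x hx
    exact (hx.differentiableAt (hU.mem_nhds hs₀)).hasDerivAt
  refine (hasDerivAt_integral_of_dominated_loc_of_deriv_le (F := F)
    (F' := fun s x => deriv (fun s => F s x) s) (bound := fun x => g x / r)
    (Metric.ball_mem_nhds s₀ hr0) ?_ ?_ ?_ ?_ (hg.div_const r) ?_).2.differentiableAt
      |>.differentiableWithinAt
  · filter_upwards [hU.mem_nhds hs₀] with s hs using hmeas s hs
  · refine hg.mono' (hmeas _ hs₀) ?_
    filter_upwards [hFg] with x hx
    exact hx _ (Metric.mem_closedBall_self (by positivity))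
  -- The derivative is measurable in `x` as an a.e. limit of difference quotients along a sequence;
  -- the shift by `n₀` keeps the sequence inside `U`.
  · obtain ⟨u, hu⟩ := exists_seq_tendsto (𝓝[≠] s₀)
    have hu' := hu.eventually (eventually_nhdsWithin_of_eventually_nhds (hU.mem_nhds hs₀))
    obtain ⟨n₀, hn₀⟩ := eventually_atTop.1 hu'
    refine aestronglyMeasurable_of_tendsto_ae atTop
      (f := fun n x => slope (fun s => F s x) s₀ (u (n + n₀))) (fun n => ?_) ?_
    · simp only [slope, vsub_eq_sub]
      exact ((hmeas _ (hn₀ _ (Nat.le_add_left _ _))).sub (hmeas _ hs₀)).const_smul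
        (u (n + n₀) - s₀)⁻¹
    · filter_upwards [hderiv] with x hx
      exact (hasDerivAt_iff_tendsto_slope.1 hx).comp (hu.comp (tendsto_add_atTop_nat n₀))
  · filter_upwards [hdiff, hFg] with x hx hxg s hs
    refine Complex.norm_deriv_le_of_forall_mem_sphere_norm_le hr0 ?_ ?_
    · refine DifferentiableOn.diffContOnCl (hx.mono ?_)
      refine Metric.closure_ball_subset_closedBall.trans (Subset.trans ?_ hKU)
      refine Metric.closedBall_subset_closedBall' ?_
      rw [Metric.mem_ball] at hs
      linarith
    · intro z hz
      refine hxg z ?_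
      rw [Metric.mem_sphere] at hz
      rw [Metric.mem_ball] at hs
      rw [Metric.mem_closedBall]
      linarith [dist_triangle z s s₀]
  · filter_upwards [hdiff] with x hx s hs
    exact (hx.differentiableAt (hU.mem_nhds (hball hs))).hasDerivAt

/-! ### Functions with at most a simple pole -/

/-- `G` has at most a simple pole at `z`, with residue `r`. -/
def HasSimpleResidueAt (G : ℂ → ℂ) (r z : ℂ) : Prop :=
  ∃ ψ : ℂ → ℂ, AnalyticAt ℂ ψ z ∧ ψ z = r ∧ ∀ᶠ s in 𝓝[≠] z, G s = ψ s / (s - z)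

namespace HasSimpleResidueAt

variable {G H : ℂ → ℂ} {r q z : ℂ}

theorem congr (h : HasSimpleResidueAt G r z) (hGH : H =ᶠ[𝓝[≠] z] G) :
    HasSimpleResidueAt H r z := by
  obtain ⟨ψ, h1, h2, h3⟩ := h
  exact ⟨ψ, h1, h2, by filter_upwards [h3, hGH] with s hs hs' using hs'.trans hs⟩

theorem add (hG : HasSimpleResidueAt G r z) (hH : HasSimpleResidueAt H q z) :
    HasSimpleResidueAt (fun s => G s + H s) (r + q) z := by
  obtain ⟨ψ, h1, h2, h3⟩ := hG
  obtain ⟨φ, k1, k2, k3⟩ := hH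
  refine ⟨fun s => ψ s + φ s, h1.add k1, by simp [h2, k2], ?_⟩
  filter_upwards [h3, k3] with s hs hs'
  rw [hs, hs', add_div]

theorem mul_analytic (hG : HasSimpleResidueAt G r z) {f : ℂ → ℂ} (hf : AnalyticAt ℂ f z) :
    HasSimpleResidueAt (fun s => f s * G s) (f z * r) z := by
  obtain ⟨ψ, h1, h2, h3⟩ := hG
  refine ⟨fun s => f s * ψ s, hf.mul h1, by simp [h2], ?_⟩
  filter_upwards [h3] with s hs
  rw [hs, mul_div_assoc]

theorem of_analyticAt (hG : AnalyticAt ℂ G z) : HasSimpleResidueAt G 0 z := by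
  refine ⟨fun s => (s - z) * G s, (analyticAt_id.sub analyticAt_const).mul hG, by simp, ?_⟩
  filter_upwards [self_mem_nhdsWithin] with s hs
  rw [mul_div_cancel_left₀ _ (sub_ne_zero.2 hs)]

theorem sum {ι : Type*} {G : ι → ℂ → ℂ} {r : ι → ℂ} (t : Finset ι)
    (h : ∀ i ∈ t, HasSimpleResidueAt (G i) (r i) z) :
    HasSimpleResidueAt (fun s => ∑ i ∈ t, G i s) (∑ i ∈ t, r i) z := by
  classical
  induction t using Finset.induction_on with
  | empty => simpa using of_analyticAt (G := fun _ => (0 : ℂ)) analyticAt_const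
  | insert a t ha ih =>
    simp only [Finset.sum_insert ha]
    exact (h a (Finset.mem_insert_self a t)).add
      (ih fun i hi => h i (Finset.mem_insert_of_mem hi))

theorem div_linear {f : ℂ → ℂ} (hf : AnalyticAt ℂ f z) {a : ℂ} (ha : a ≠ 0) (b : ℂ) :
    HasSimpleResidueAt (fun s => f s / (a * s + b)) (if a * z + b = 0 then f z / a else 0) z := by
  split_ifs with h
  · refine ⟨fun s => f s / a, hf.div analyticAt_const ha, rfl, Eventually.of_forall fun s => ?_⟩
    have : a * s + b = a * (s - z) := by linear_combination h
    simp only [this, div_div]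
  · exact of_analyticAt (hf.div ((analyticAt_const.mul analyticAt_id).add analyticAt_const) h)

theorem meromorphicAt (h : HasSimpleResidueAt G r z) : MeromorphicAt G z := by
  obtain ⟨ψ, h1, h2, h3⟩ := h
  refine MeromorphicAt.congr (h1.meromorphicAt.div
    (analyticAt_id.sub analyticAt_const : AnalyticAt ℂ (fun s : ℂ => s - z) z).meromorphicAt) ?_
  filter_upwards [h3] with s hs
  simp [hs]

theorem meromorphicOrderAt_eq (h : HasSimpleResidueAt G r z) (hr : r ≠ 0) :
    meromorphicOrderAt G z = -1 := by
  have hm := h.meromorphicAt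
  obtain ⟨ψ, h1, h2, h3⟩ := h
  have := (meromorphicOrderAt_eq_int_iff (n := -1) hm).2 ⟨ψ, h1, by rwa [h2], by
    filter_upwards [h3] with s hs
    rw [hs, zpow_neg_one, smul_eq_mul, div_eq_inv_mul]⟩
  simpa using this

/-- When `ψ z = 0` the quotient `ψ s / (s - z)` is the slope of `ψ`, which tends to `deriv ψ z`. -/
theorem meromorphicOrderAt_nonneg (h : HasSimpleResidueAt G 0 z) :
    0 ≤ meromorphicOrderAt G z := by
  have hm := h.meromorphicAt
  obtain ⟨ψ, h1, h2, h3⟩ := h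
  refine (tendsto_nhds_iff_meromorphicOrderAt_nonneg hm).1 ⟨deriv ψ z, ?_⟩
  refine (hasDerivAt_iff_tendsto_slope.1 h1.differentiableAt.hasDerivAt).congr' ?_
  filter_upwards [h3] with s hs
  rw [hs, slope_def_field, h2, sub_zero]

end HasSimpleResidueAt

/-! ### The identity theorem for meromorphic functions -/

theorem meromorphicOrderAt_sub_eq_top_of_eventuallyEq {F G : ℂ → ℂ} {z : ℂ}
    (h : F =ᶠ[𝓝[≠] z] G) : meromorphicOrderAt (F - G) z = ⊤ := by
  rw [meromorphicOrderAt_eq_top_iff]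
  filter_upwards [h] with s hs
  simp [hs]

/-- Local equality means that `F - G` has order `⊤`, and finiteness of the order at one point
propagates over a preconnected set. -/
theorem eventuallyEq_of_meromorphicOn {F G : ℂ → ℂ} {U : Set ℂ} (hU : IsPreconnected U)
    (hF : MeromorphicOn F U) (hG : MeromorphicOn G U) {z w : ℂ} (hz : z ∈ U) (hw : w ∈ U)
    (h : F =ᶠ[𝓝[≠] z] G) : F =ᶠ[𝓝[≠] w] G := by
  by_contra hne
  refine MeromorphicOn.meromorphicOrderAt_ne_top_of_isPreconnected (hF.sub hG) hU hw hz
    (fun htop => hne ?_) (meromorphicOrderAt_sub_eq_top_of_eventuallyEq h)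
  rw [meromorphicOrderAt_eq_top_iff] at htop
  filter_upwards [htop] with s hs
  exact sub_eq_zero.1 hs

/-- Meromorphic functions on the half planes `-N < re s` that agree on a nonempty open set glue to
a meromorphic function on `ℂ`. -/
theorem exists_meromorphic_of_halfPlanes {F : ℕ → ℂ → ℂ}
    (hF : ∀ N, MeromorphicOn (F N) {s | -(N : ℝ) < s.re}) {z : ℂ} (hz : 0 < z.re)
    (h : ∀ N, F N =ᶠ[𝓝[≠] z] F 0) :
    ∃ G : ℂ → ℂ, ∀ N : ℕ, ∀ w : ℂ, -(N : ℝ) < w.re → G =ᶠ[𝓝[≠] w] F N := by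
  have key : ∀ N M : ℕ, N ≤ M → ∀ w : ℂ, -(N : ℝ) < w.re → F N =ᶠ[𝓝[≠] w] F M := by
    intro N M hNM w hw
    have hsub : {s : ℂ | -(N : ℝ) < s.re} ⊆ {s | -(M : ℝ) < s.re} := fun s hs => by
      have : (N : ℝ) ≤ M := by exact_mod_cast hNM
      simp only [mem_ofPred_eq] at hs ⊢
      linarith
    have hz' : z ∈ {s : ℂ | -(N : ℝ) < s.re} := by
      have : (0 : ℝ) ≤ N := N.cast_nonneg
      simp only [mem_ofPred_eq]
      linarith
    exact eventuallyEq_of_meromorphicOn (convex_halfSpace_re_gt _).isPreconnected (hF N)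
      ((hF M).mono_set hsub) hz' hw ((h N).trans (h M).symm)
  -- The `+ 2` leaves a margin: the chosen half plane contains not only `s` but every `w` with
  -- `|s.re - w.re| < 1`.
  refine ⟨fun s => F (⌊|s.re|⌋₊ + 2) s, fun N w hw => ?_⟩
  -- `M` bounds `N` and every index selected near `w`, so only finitely many local equalities have
  -- to hold together.
  set M := ⌊|w.re| + 1⌋₊ + 2 + N with hM
  have hall : ∀ᶠ s in 𝓝[≠] w, ∀ n ∈ Finset.range (M + 1), -(n : ℝ) < w.re → F n s = F M s := by
    rw [Filter.eventually_all_finset]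
    intro n hn
    by_cases hnw : -(n : ℝ) < w.re
    · filter_upwards [key n M (by simpa [Nat.lt_succ_iff] using hn) w hnw] with s hs _ using hs
    · exact Eventually.of_forall fun s hs => absurd hs hnw
  have hnear : ∀ᶠ s : ℂ in 𝓝[≠] w, |s.re - w.re| < 1 := by
    refine eventually_nhdsWithin_of_eventually_nhds ?_
    have hc : Continuous fun s : ℂ => |s.re - w.re| := by fun_prop
    exact hc.continuousAt.eventually (eventually_lt_nhds (by simp))
  filter_upwards [hall, hnear] with s hs hs'
  rw [abs_lt] at hs'
  have habs : |s.re| ≤ |w.re| + 1 := by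
    rw [abs_le]
    constructor <;> linarith [neg_abs_le w.re, le_abs_self w.re]
  have hfl := Nat.lt_floor_add_one |s.re|
  refine (hs _ ?_ ?_).trans (hs N ?_ hw).symm
  · have := Nat.floor_le_floor habs
    simp only [Finset.mem_range]
    omega
  · push_cast
    linarith [neg_abs_le s.re]
  · simp only [Finset.mem_range]
    omega

/-! ### The exponential sums `∑ n ^ (-s) * exp (-n x)` -/

/-- The function `∑ n ≥ 1, n ^ (-s) * exp (-n x)`, which is the polylogarithm of order `s` at
`exp (-x)`. -/
noncomputable def expSum (s : ℂ) (x : ℝ) : ℂ :=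
  ∑' n : ℕ+, ((n : ℕ) : ℂ) ^ (-s) * Complex.exp (-(((n : ℕ) : ℂ) * x))

theorem norm_expSum_term (s : ℂ) (x : ℝ) (n : ℕ+) :
    ‖((n : ℕ) : ℂ) ^ (-s) * Complex.exp (-(((n : ℕ) : ℂ) * x))‖ =
      ((n : ℕ) : ℝ) ^ (-s.re) * Real.exp (-((n : ℕ) * x)) := by
  rw [norm_mul, Complex.norm_natCast_cpow_of_pos n.pos, Complex.norm_exp]
  simp

theorem norm_expSum_term_le {s : ℂ} {k : ℕ} (hs : -s.re ≤ k) {x δ : ℝ} (hx : δ ≤ x) (n : ℕ+) :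
    ‖((n : ℕ) : ℂ) ^ (-s) * Complex.exp (-(((n : ℕ) : ℂ) * x))‖ ≤
      ((n : ℕ) : ℝ) ^ k * Real.exp (-δ * (n : ℕ)) := by
  rw [norm_expSum_term]
  have hn : (1 : ℝ) ≤ (n : ℕ) := by exact_mod_cast (one_le : 1 ≤ n)
  gcongr
  · rw [← Real.rpow_natCast]
    exact Real.rpow_le_rpow_of_exponent_le hn hs
  · nlinarith

theorem summable_pnat_pow_mul_exp (k : ℕ) {δ : ℝ} (hδ : 0 < δ) :
    Summable fun n : ℕ+ => ((n : ℕ) : ℝ) ^ k * Real.exp (-δ * (n : ℕ)) :=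
  (Real.summable_pow_mul_exp_neg_nat_mul k hδ).comp_injective PNat.coe_injective

theorem summable_expSum (s : ℂ) {x : ℝ} (hx : 0 < x) :
    Summable fun n : ℕ+ => ‖((n : ℕ) : ℂ) ^ (-s) * Complex.exp (-(((n : ℕ) : ℂ) * x))‖ :=
  (summable_pnat_pow_mul_exp ⌈-s.re⌉₊ hx).of_nonneg_of_le (fun _ => norm_nonneg _)
    (norm_expSum_term_le (Nat.le_ceil _) le_rfl)

theorem hasDerivAt_expSum (s : ℂ) {x : ℝ} (hx : 0 < x) :
    HasDerivAt (expSum s) (-expSum (s - 1) x) x := by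
  have h := hasDerivAt_tsum_of_isPreconnected
    (g := fun (n : ℕ+) (x : ℝ) => ((n : ℕ) : ℂ) ^ (-s) * Complex.exp (-(((n : ℕ) : ℂ) * x)))
    (g' := fun (n : ℕ+) (x : ℝ) =>
      -(((n : ℕ) : ℂ) ^ (-(s - 1)) * Complex.exp (-(((n : ℕ) : ℂ) * x))))
    (t := Ioi (x / 2)) (y₀ := x) (y := x)
    (summable_pnat_pow_mul_exp ⌈-(s - 1).re⌉₊ (half_pos hx)) isOpen_Ioi
    (convex_Ioi _).isPreconnected ?_ ?_ (by simp [hx]) (summable_expSum s hx).of_norm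
    (by simp [hx])
  · rw [tsum_neg] at h
    exact h
  · intro n y _
    have hn : ((n : ℕ) : ℂ) ≠ 0 := by exact_mod_cast n.ne_zero
    have h1 : HasDerivAt (fun y : ℝ => -(((n : ℕ) : ℂ) * (y : ℂ))) (-((n : ℕ) : ℂ)) y := by
      simpa using ((Complex.ofRealCLM.hasDerivAt (x := y)).const_mul ((n : ℕ) : ℂ)).fun_neg
    refine (h1.cexp.const_mul _).congr_deriv ?_
    rw [show -(s - 1) = -s + 1 by ring, Complex.cpow_add _ _ hn, Complex.cpow_one]
    ring
  · intro n y hy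
    rw [norm_neg]
    exact norm_expSum_term_le (Nat.le_ceil _) (le_of_lt hy) n

theorem continuousOn_expSum (s : ℂ) : ContinuousOn (expSum s) (Ioi 0) :=
  fun _ hx => (hasDerivAt_expSum s hx).continuousAt.continuousWithinAt

theorem differentiable_expSum {x : ℝ} (hx : 0 < x) : Differentiable ℂ fun s => expSum s x := by
  intro s
  obtain ⟨k, hk⟩ := exists_nat_gt (-s.re)
  have hU : IsOpen {s : ℂ | -(k : ℝ) < s.re} := isOpen_lt continuous_const Complex.continuous_re
  refine (Complex.differentiableOn_tsum_of_summable_norm (summable_pnat_pow_mul_exp k hx)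
    (fun n => ?_) hU fun n w hw => ?_).differentiableAt (hU.mem_nhds ?_)
  · have hn : ((n : ℕ) : ℂ) ≠ 0 := by exact_mod_cast n.ne_zero
    intro w _
    exact ((differentiableAt_id.neg.const_cpow (Or.inl hn)).mul_const _).differentiableWithinAt
  · simp only [mem_ofPred_eq] at hw
    exact norm_expSum_term_le (by linarith) le_rfl n
  · simp only [mem_ofPred_eq]
    linarith

theorem exists_norm_expSum_le {K : Set ℂ} (hK : IsCompact K) :
    ∃ C : ℝ, ∀ s ∈ K, ∀ x : ℝ, 1 ≤ x → ‖expSum s x‖ ≤ C * Real.exp (-x) := by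
  obtain ⟨k, hk⟩ : ∃ k : ℕ, ∀ s ∈ K, -s.re ≤ k := by
    obtain ⟨b, hb⟩ := (hK.image Complex.continuous_re.neg).bddAbove
    obtain ⟨k, hk⟩ := exists_nat_ge b
    exact ⟨k, fun s hs => (hb (mem_image_of_mem _ hs)).trans hk⟩
  have hS := (summable_pnat_pow_mul_exp k one_pos).mul_left (Real.exp 1)
  refine ⟨∑' n : ℕ+, Real.exp 1 * (((n : ℕ) : ℝ) ^ k * Real.exp (-1 * (n : ℕ))),
    fun s hs x hx => ?_⟩
  rw [← tsum_mul_right]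
  refine tsum_of_norm_bounded (hS.mul_right _).hasSum fun n => ?_
  refine (norm_expSum_term_le (hk s hs) le_rfl n).trans ?_
  have hn : (1 : ℝ) ≤ (n : ℕ) := by exact_mod_cast (one_le : 1 ≤ n)
  rw [show Real.exp 1 * (((n : ℕ) : ℝ) ^ k * Real.exp (-1 * (n : ℕ))) * Real.exp (-x) =
    ((n : ℕ) : ℝ) ^ k * Real.exp (1 + -1 * (n : ℕ) + -x) by rw [Real.exp_add, Real.exp_add]; ring]
  gcongr
  -- This is `(n - 1) * (x - 1) ≥ 0`.
  nlinarith

/-- The regular part at `x = 0` of `expSum s x`. -/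
noncomputable def expRem (s : ℂ) (x : ℝ) : ℂ :=
  expSum s x - Complex.Gamma (1 - s) * (x : ℂ) ^ (s - 1)

theorem one_sub_ne_neg_nat {s : ℂ} (hs : s.re < 1) (m : ℕ) : 1 - s ≠ -m := by
  intro h
  have := congrArg Complex.re h
  simp only [Complex.sub_re, Complex.one_re, Complex.neg_re, Complex.natCast_re] at this
  have hm : (0 : ℝ) ≤ m := m.cast_nonneg
  linarith

/-- The singular term obeys the same rule `f_s' = -f_(s-1)` as `expSum`, because Γ(2-s) = (1-s)
Γ(1-s). -/
theorem hasDerivAt_expRem {s : ℂ} (hs : s.re < 1) {x : ℝ} (hx : 0 < x) :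
    HasDerivAt (expRem s) (-expRem (s - 1) x) x := by
  have h1 : (1 - s) ≠ 0 := by simpa using one_sub_ne_neg_nat hs 0
  have hp : HasDerivAt (fun y : ℝ => (y : ℂ) ^ (s - 1)) ((s - 1) * (x : ℂ) ^ (s - 1 - 1)) x := by
    have := (hasDerivAt_id (x : ℂ)).cpow_const (c := s - 1) (Or.inl (by simpa using hx))
    simpa using this.comp_ofReal
  refine ((hasDerivAt_expSum s hx).sub (hp.const_mul _)).congr_deriv ?_
  rw [expRem, show 1 - (s - 1) = (1 - s) + 1 by ring, Complex.Gamma_add_one _ h1]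
  ring

theorem continuousOn_expRem {s : ℂ} (hs : s.re < 1) : ContinuousOn (expRem s) (Ioi 0) :=
  fun _ hx => (hasDerivAt_expRem hs hx).continuousAt.continuousWithinAt

theorem isOpen_re_lt_one : IsOpen {s : ℂ | s.re < 1} :=
  isOpen_lt Complex.continuous_re continuous_const

theorem differentiableAt_Gamma_one_sub {s : ℂ} (hs : s.re < 1) :
    DifferentiableAt ℂ (fun s => Complex.Gamma (1 - s)) s :=
  (Complex.differentiableAt_Gamma _ (one_sub_ne_neg_nat hs)).comp s
    ((differentiableAt_const _).sub differentiableAt_id)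

theorem differentiableOn_expRem {x : ℝ} (hx : 0 < x) :
    DifferentiableOn ℂ (fun s => expRem s x) {s | s.re < 1} := by
  intro s hs
  have hx' : (x : ℂ) ≠ 0 := by exact_mod_cast hx.ne'
  refine DifferentiableAt.differentiableWithinAt ?_
  exact (differentiable_expSum hx s).sub ((differentiableAt_Gamma_one_sub hs).mul
    ((differentiableAt_id.sub_const 1).const_cpow (Or.inl hx')))

/-! ### The Laplace transform of a power, with complex rate -/

theorem integrableOn_rpow_mul_exp_neg_mul {a b : ℝ} (ha : -1 < a) (hb : 0 < b) :
    IntegrableOn (fun x : ℝ => x ^ a * Real.exp (-b * x)) (Ioi 0) := by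
  simpa using integrableOn_rpow_mul_exp_neg_mul_rpow (p := 1) ha one_pos hb

theorem continuousOn_ofReal_cpow (w : ℂ) : ContinuousOn (fun t : ℝ => (t : ℂ) ^ w) (Ioi 0) :=
  fun t ht => (Complex.continuousAt_ofReal_cpow_const t w (Or.inr (ne_of_gt ht))).continuousWithinAt

theorem norm_cpow_mul_exp {a r : ℂ} {t : ℝ} (ht : 0 < t) :
    ‖(t : ℂ) ^ (a - 1) * Complex.exp (-(r * t))‖ = t ^ (a.re - 1) * Real.exp (-r.re * t) := by
  rw [norm_mul, Complex.norm_cpow_eq_rpow_re_of_pos ht, Complex.norm_exp]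
  simp

/-- Both sides are holomorphic in `r` on the right half plane and agree for real `r`, so the
identity theorem applies. -/
theorem integral_cpow_mul_exp_neg_complex_mul_Ioi {a r : ℂ} (ha : 0 < a.re) (hr : 0 < r.re) :
    ∫ t : ℝ in Ioi 0, (t : ℂ) ^ (a - 1) * Complex.exp (-(r * t)) =
      r ^ (-a) * Complex.Gamma a := by
  have hU : IsOpen {r : ℂ | 0 < r.re} := isOpen_lt continuous_const Complex.continuous_re
  have h1 : DifferentiableOn ℂ
      (fun r : ℂ => ∫ t : ℝ in Ioi 0, (t : ℂ) ^ (a - 1) * Complex.exp (-(r * t)))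
      {r : ℂ | 0 < r.re} := by
    refine differentiableOn_integral_of_dominated hU (fun s _ => ?_) ?_ fun K hKU hK => ?_
    · refine ContinuousOn.aestronglyMeasurable ?_ measurableSet_Ioi
      exact (continuousOn_ofReal_cpow _).mul (by fun_prop)
    · exact Eventually.of_forall fun t => by fun_prop
    · rcases K.eq_empty_or_nonempty with rfl | hne
      · exact ⟨fun _ => 0, integrable_zero _ _ _, by simp⟩
      obtain ⟨z, hz, hmin⟩ := hK.exists_isMinOn hne Complex.continuous_re.continuousOn
      refine ⟨_, integrableOn_rpow_mul_exp_neg_mul (a := a.re - 1) (b := z.re) (by linarith)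
        (hKU hz), ?_⟩
      filter_upwards [ae_restrict_mem measurableSet_Ioi] with t ht s hs
      rw [norm_cpow_mul_exp ht]
      have hzs : z.re ≤ s.re := hmin hs
      have ht0 : (0 : ℝ) < t := ht
      gcongr
  have h2 : DifferentiableOn ℂ (fun r : ℂ => r ^ (-a) * Complex.Gamma a) {r : ℂ | 0 < r.re} := by
    intro s hs
    exact ((differentiableAt_id.cpow_const (Or.inl hs)).mul_const _).differentiableWithinAt
  refine (h1.analyticOnNhd hU).eqOn_of_preconnected_of_frequently_eq (h2.analyticOnNhd hU)
    (convex_halfSpace_re_gt _).isPreconnected (z₀ := 1) (by simp) ?_ hr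
  have hreal : ∃ᶠ x : ℝ in 𝓝[≠] 1,
      (∫ t : ℝ in Ioi 0, (t : ℂ) ^ (a - 1) * Complex.exp (-((x : ℂ) * t))) =
        (x : ℂ) ^ (-a) * Complex.Gamma a := by
    refine Eventually.frequently ?_
    filter_upwards [eventually_nhdsWithin_of_eventually_nhds (eventually_gt_nhds one_pos)]
      with x hx
    rw [Complex.integral_cpow_mul_exp_neg_mul_Ioi ha hx, one_div, Complex.inv_cpow,
      Complex.cpow_neg]
    rw [Complex.arg_ofReal_of_nonneg hx.le]
    exact Real.pi_pos.ne
  have htend : Tendsto (fun x : ℝ => (x : ℂ)) (𝓝[≠] 1) (𝓝[≠] (1 : ℂ)) := by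
    refine tendsto_nhdsWithin_iff.2 ⟨?_, ?_⟩
    · have : Tendsto (fun x : ℝ => (x : ℂ)) (𝓝 1) (𝓝 ((1 : ℝ) : ℂ)) :=
        Complex.continuous_ofReal.continuousAt
      rw [Complex.ofReal_one] at this
      exact this.mono_left nhdsWithin_le_nhds
    · filter_upwards [self_mem_nhdsWithin] with x hx
      simpa using hx
  exact htend.frequently hreal

/-! ### Poisson summation -/

/-- The function `y ↦ y ^ (-s) * exp (-x y)` on the positive half line, extended by zero. -/
noncomputable def powExp (s : ℂ) (x y : ℝ) : ℂ :=
  ((max y 0 : ℝ) : ℂ) ^ (-s) * Complex.exp (-(y * x))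

theorem powExp_of_nonpos {s : ℂ} (hs : s.re < 0) (x : ℝ) {y : ℝ} (hy : y ≤ 0) :
    powExp s x y = 0 := by
  have : -s ≠ 0 := by
    rintro h
    have := congrArg Complex.re h
    simp at this
    linarith
  rw [powExp, max_eq_right hy, Complex.ofReal_zero, Complex.zero_cpow this, zero_mul]

theorem powExp_of_pos (s : ℂ) (x : ℝ) {y : ℝ} (hy : 0 < y) :
    powExp s x y = (y : ℂ) ^ (-s) * Complex.exp (-(y * x)) := by
  rw [powExp, max_eq_left hy.le]

theorem continuous_powExp {s : ℂ} (hs : s.re < 0) (x : ℝ) : Continuous (powExp s x) := by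
  have h : Continuous fun y : ℝ => (y : ℂ) ^ (-s) :=
    Complex.continuous_ofReal_cpow_const (by simpa using hs)
  exact (h.comp (continuous_id.max continuous_const)).mul (by fun_prop)

theorem isBigO_powExp {s : ℂ} (hs : s.re < 0) {x : ℝ} (hx : 0 < x) (b : ℝ) :
    powExp s x =O[cocompact ℝ] fun y : ℝ => |y| ^ (-b) := by
  rw [cocompact_eq_atBot_atTop, Asymptotics.isBigO_sup]
  constructor
  · refine (Asymptotics.isBigO_zero _ _).congr' ?_ EventuallyEq.rfl
    filter_upwards [eventually_le_atBot 0] with y hy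
    rw [powExp_of_nonpos hs x hy]
  · have h := (Asymptotics.isBigO_refl (fun y : ℝ => y ^ (-s.re)) atTop).mul
      (isLittleO_exp_neg_mul_rpow_atTop hx (-b + s.re)).isBigO
    refine Asymptotics.IsBigO.trans (Asymptotics.IsBigO.of_bound 1 ?_) (h.congr'
      (EventuallyEq.refl _ _) (g₂ := fun y : ℝ => |y| ^ (-b)) ?_)
    · filter_upwards [eventually_gt_atTop 0] with y hy
      rw [powExp_of_pos s x hy, norm_mul, Complex.norm_cpow_eq_rpow_re_of_pos hy,
        Complex.norm_exp, Real.norm_of_nonneg (by positivity)]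
      simp [mul_comm]
    · filter_upwards [eventually_gt_atTop 0] with y hy
      rw [← Real.rpow_add hy, abs_of_pos hy]
      congr 1
      ring

/-- The Fourier integral is the Laplace transform of a power at the complex rate x + 2πiξ. -/
theorem fourier_powExp {s : ℂ} (hs : s.re < 0) {x : ℝ} (hx : 0 < x) (ξ : ℝ) :
    FourierTransform.fourier (powExp s x) ξ =
      Complex.Gamma (1 - s) * ((x : ℂ) + 2 * Real.pi * Complex.I * ξ) ^ (s - 1) := by
  have h := integral_cpow_mul_exp_neg_complex_mul_Ioi (a := 1 - s)
    (r := (x : ℂ) + 2 * Real.pi * Complex.I * ξ) (by simp; linarith) (by simpa using hx)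
  rw [neg_sub, mul_comm _ (Complex.Gamma _)] at h
  rw [← h, Real.fourier_real_eq_integral_exp_smul]
  rw [← integral_indicator measurableSet_Ioi]
  refine integral_congr_ae (Eventually.of_forall fun y => ?_)
  by_cases hy : 0 < y
  · simp only [indicator_of_mem (mem_Ioi.2 hy), powExp_of_pos s x hy, smul_eq_mul]
    rw [mul_left_comm, ← Complex.exp_add, show 1 - s - 1 = -s by ring]
    congr 2
    push_cast
    ring
  · simp only [indicator_of_notMem (show y ∉ Ioi (0 : ℝ) from hy),
      powExp_of_nonpos hs x (not_lt.1 hy), smul_zero]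

/-- The terms of the Lipschitz summation formula, without the zeroth one. -/
noncomputable def lipschitzTerm (s : ℂ) (x : ℝ) (k : ℤ) : ℂ :=
  if k = 0 then 0 else ((x : ℂ) + 2 * Real.pi * Complex.I * k) ^ (s - 1)

/-- The modulus of x + 2πik is at least |k|, and its argument, at most π in size, costs the
exponential factor. The bound is free of `x`, which permits the limit x → 0. -/
theorem norm_lipschitzTerm_le {s : ℂ} (hs : s.re < 0) (x : ℝ) (k : ℤ) :
    ‖lipschitzTerm s x k‖ ≤ Real.exp (Real.pi * |s.im|) * |(k : ℝ)| ^ (-(1 - s.re)) := by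
  rw [lipschitzTerm]
  split_ifs with hk
  · rw [norm_zero]
    positivity
  have hk1 : (1 : ℝ) ≤ |(k : ℝ)| := by exact_mod_cast Int.one_le_abs hk
  set r : ℂ := (x : ℂ) + 2 * Real.pi * Complex.I * k with hr
  have hrim : r.im = 2 * Real.pi * k := by simp [hr]
  have hrk : |(k : ℝ)| ≤ ‖r‖ := by
    refine le_trans ?_ (Complex.abs_im_le_norm r)
    rw [hrim, abs_mul, abs_of_pos Real.two_pi_pos]
    nlinarith [Real.pi_gt_three]
  refine (Complex.norm_cpow_le _ _).trans ?_
  rw [div_eq_mul_inv, ← Real.exp_neg, mul_comm]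
  gcongr ?_ * ?_
  · refine Real.exp_le_exp.2 ((neg_le_abs _).trans ?_)
    rw [abs_mul]
    simp only [Complex.sub_im, Complex.one_im, sub_zero]
    gcongr
    exact Complex.abs_arg_le_pi r
  · rw [show -(1 - s.re) = (s - 1).re by simp]
    exact Real.rpow_le_rpow_of_nonpos (by positivity) hrk (by simp; linarith)

theorem summable_lipschitz_bound {s : ℂ} (hs : s.re < 0) :
    Summable fun k : ℤ => Real.exp (Real.pi * |s.im|) * |(k : ℝ)| ^ (-(1 - s.re)) :=
  (Real.summable_abs_int_rpow (by linarith)).mul_left _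

theorem summable_lipschitzTerm {s : ℂ} (hs : s.re < 0) (x : ℝ) :
    Summable (lipschitzTerm s x) :=
  (summable_lipschitz_bound hs).of_norm_bounded (norm_lipschitzTerm_le hs x)

/-- Poisson summation applied to `powExp` (Lipschitz's formula). The frequency k = 0 contributes
exactly the subtracted term Γ(1-s) x^(s-1). The condition Re s < 0 makes `powExp` continuous at 0
and the frequency sum absolutely convergent. -/
theorem expRem_eq_tsum {s : ℂ} (hs : s.re < 0) {x : ℝ} (hx : 0 < x) :
    expRem s x = Complex.Gamma (1 - s) * ∑' k : ℤ, lipschitzTerm s x k := by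
  set u : ℤ → ℂ := fun k => ((x : ℂ) + 2 * Real.pi * Complex.I * k) ^ (s - 1) with hu
  have hus : Summable u := by
    refine (summable_congr_cofinite ?_).1 (summable_lipschitzTerm hs x)
    have : ∀ᶠ k : ℤ in cofinite, k ≠ 0 := (Set.finite_singleton 0).compl_mem_cofinite
    filter_upwards [this] with k hk
    rw [lipschitzTerm, if_neg hk]
  have hF : ∀ k : ℤ, FourierTransform.fourier (powExp s x) (k : ℝ) =
      Complex.Gamma (1 - s) * u k := fun k => by
    rw [fourier_powExp hs hx, hu]
    simp
  have hP := Real.tsum_eq_tsum_fourier_of_rpow_decay_of_summable (continuous_powExp hs x)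
    one_lt_two (isBigO_powExp hs hx 2) (by simpa only [hF] using hus.mul_left _) 0
  simp only [hF, zero_add, QuotientAddGroup.mk_zero, fourier_eval_zero, mul_one,
    tsum_mul_left] at hP
  have hL : expSum s x = ∑' n : ℤ, powExp s x n := by
    have hinj : Function.Injective fun n : ℕ+ => ((n : ℕ) : ℤ) :=
      Nat.cast_injective.comp PNat.coe_injective
    rw [← hinj.tsum_eq]
    · refine tsum_congr fun n => ?_
      rw [powExp_of_pos s x (by exact_mod_cast n.pos)]
      simp
    · intro k hk
      have hk0 : 0 < k := by
        by_contra h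
        exact hk (powExp_of_nonpos hs x (by exact_mod_cast not_lt.1 h))
      exact ⟨⟨k.toNat, by omega⟩, by simpa using hk0.le⟩
  rw [expRem, hL, hP, hus.tsum_eq_add_tsum_ite 0, mul_add]
  simp [hu, lipschitzTerm]

theorem exists_norm_expRem_le_of_re_neg {K : Set ℂ} (hK : IsCompact K)
    (hKU : K ⊆ {s | s.re < 0}) :
    ∃ C : ℝ, ∀ s ∈ K, ∀ x : ℝ, 0 < x → ‖expRem s x‖ ≤ C := by
  rcases K.eq_empty_or_nonempty with rfl | hne
  · exact ⟨0, by simp⟩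
  obtain ⟨z, hz, hmax⟩ := hK.exists_isMaxOn hne Complex.continuous_re.continuousOn
  have hz0 : z.re < 0 := hKU hz
  have hcont : ContinuousOn (fun s : ℂ =>
      ‖Complex.Gamma (1 - s)‖ * Real.exp (Real.pi * |s.im|)) K := by
    refine ContinuousOn.mul (fun s hs => ?_) (by fun_prop)
    exact (differentiableAt_Gamma_one_sub
      (lt_trans (hKU hs) one_pos)).continuousAt.norm.continuousWithinAt
  obtain ⟨B, hB⟩ := hK.bddAbove_image hcont
  refine ⟨B * ∑' k : ℤ, |(k : ℝ)| ^ (-(1 - z.re)), fun s hs x hx => ?_⟩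
  have hsum : Summable fun k : ℤ => |(k : ℝ)| ^ (-(1 - z.re)) :=
    Real.summable_abs_int_rpow (by linarith)
  have hs0 : s.re < 0 := hKU hs
  have hsz : s.re ≤ z.re := hmax hs
  have h1 : ‖∑' k : ℤ, lipschitzTerm s x k‖ ≤
      Real.exp (Real.pi * |s.im|) * ∑' k : ℤ, |(k : ℝ)| ^ (-(1 - z.re)) := by
    refine tsum_of_norm_bounded (hsum.hasSum.mul_left _) fun k => ?_
    refine (norm_lipschitzTerm_le hs0 x k).trans ?_
    gcongr ?_ * ?_
    rcases eq_or_ne k 0 with rfl | hk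
    -- Both sides vanish at k = 0, since `0 ^ a = 0` for every nonzero real exponent, negative ones
    -- included.
    · rw [Int.cast_zero, abs_zero, Real.zero_rpow (by linarith), Real.zero_rpow (by linarith)]
    · exact Real.rpow_le_rpow_of_exponent_le (by exact_mod_cast Int.one_le_abs hk) (by linarith)
  rw [expRem_eq_tsum hs0 hx, norm_mul]
  have hBs : ‖Complex.Gamma (1 - s)‖ * Real.exp (Real.pi * |s.im|) ≤ B :=
    hB (mem_image_of_mem _ hs)
  have hpos : 0 ≤ ∑' k : ℤ, |(k : ℝ)| ^ (-(1 - z.re)) := tsum_nonneg fun k => by positivity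
  calc ‖Complex.Gamma (1 - s)‖ * ‖∑' k : ℤ, lipschitzTerm s x k‖
      ≤ ‖Complex.Gamma (1 - s)‖ * (Real.exp (Real.pi * |s.im|) *
          ∑' k : ℤ, |(k : ℝ)| ^ (-(1 - z.re))) := by gcongr
    _ = ‖Complex.Gamma (1 - s)‖ * Real.exp (Real.pi * |s.im|) *
          ∑' k : ℤ, |(k : ℝ)| ^ (-(1 - z.re)) := by ring
    _ ≤ _ := by gcongr

theorem tendsto_expRem_of_re_neg {s : ℂ} (hs : s.re < 0) :
    Tendsto (expRem s) (𝓝[>] 0)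
      (𝓝 (Complex.Gamma (1 - s) * ∑' k : ℤ, lipschitzTerm s 0 k)) := by
  have h : Tendsto (fun x : ℝ => Complex.Gamma (1 - s) * ∑' k : ℤ, lipschitzTerm s x k) (𝓝[>] 0)
      (𝓝 (Complex.Gamma (1 - s) * ∑' k : ℤ, lipschitzTerm s 0 k)) := by
    refine Tendsto.const_mul _ (tendsto_tsum_of_dominated_convergence
      (summable_lipschitz_bound hs) (fun k => ?_)
      (Eventually.of_forall fun x k => norm_lipschitzTerm_le hs x k))
    simp only [lipschitzTerm]
    split_ifs with hk
    · exact tendsto_const_nhds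
    · have hc : ContinuousAt (fun x : ℝ => ((x : ℂ) + 2 * Real.pi * Complex.I * k) ^ (s - 1)) 0 := by
        refine ContinuousAt.cpow (by fun_prop) continuousAt_const (Or.inr ?_)
        simp [hk, Real.pi_ne_zero]
      exact hc.tendsto.mono_left nhdsWithin_le_nhds
  refine h.congr' ?_
  filter_upwards [self_mem_nhdsWithin] with x hx
  rw [expRem_eq_tsum hs hx]

/-! ### Behaviour of the regular part at zero -/

theorem image_sub_one_subset {K : Set ℂ} {b : ℝ} (hK : K ⊆ {s | s.re < b}) :
    (fun s : ℂ => s - 1) '' K ⊆ {s | s.re < b - 1} := by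
  rintro _ ⟨s, hs, rfl⟩
  have : s.re < b := hK hs
  simpa using this

theorem isCompact_image_sub_one {K : Set ℂ} (hK : IsCompact K) :
    IsCompact ((fun s : ℂ => s - 1) '' K) :=
  hK.image (by fun_prop)

/-- The derivative of R_s is -R_(s-1), already bounded because Re(s-1) < 0; the mean value
inequality on [x, 1] gains one unit of Re s. -/
theorem exists_norm_expRem_le {K : Set ℂ} (hK : IsCompact K) (hKU : K ⊆ {s | s.re < 1}) :
    ∃ C : ℝ, 0 ≤ C ∧ ∀ s ∈ K, ∀ x ∈ Ioc (0 : ℝ) 1, ‖expRem s x‖ ≤ C := by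
  obtain ⟨C, hC⟩ := exists_norm_expRem_le_of_re_neg (isCompact_image_sub_one hK)
    (by simpa using image_sub_one_subset hKU)
  obtain ⟨B, hB⟩ := hK.bddAbove_image
    ((differentiableOn_expRem one_pos).continuousOn.norm.mono hKU)
  refine ⟨max (C + B) 0, le_max_right _ _, fun s hs x hx => le_trans ?_ (le_max_left _ _)⟩
  have hs1 : s.re < 1 := hKU hs
  have hder : ∀ y ∈ Icc x 1, HasDerivWithinAt (expRem s) (-expRem (s - 1) y) (Icc x 1) y :=
    fun y hy => (hasDerivAt_expRem hs1 (hx.1.trans_le hy.1)).hasDerivWithinAt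
  have hbd : ∀ y ∈ Icc x 1, ‖-expRem (s - 1) y‖ ≤ C := fun y hy => by
    rw [norm_neg]
    exact hC _ (mem_image_of_mem _ hs) y (hx.1.trans_le hy.1)
  have h1 := (convex_Icc x 1).norm_image_sub_le_of_norm_hasDerivWithin_le hder hbd
    (right_mem_Icc.2 hx.2) (left_mem_Icc.2 hx.2)
  have h2 : ‖expRem s 1‖ ≤ B := hB (mem_image_of_mem _ hs)
  have hC0 : 0 ≤ C := (norm_nonneg _).trans (hbd 1 (right_mem_Icc.2 hx.2))
  have h3 : ‖x - 1‖ ≤ 1 := by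
    rw [Real.norm_eq_abs, abs_le]
    constructor <;> linarith [hx.1, hx.2]
  calc ‖expRem s x‖ = ‖(expRem s x - expRem s 1) + expRem s 1‖ := by rw [sub_add_cancel]
    _ ≤ ‖expRem s x - expRem s 1‖ + ‖expRem s 1‖ := norm_add_le _ _
    _ ≤ C * ‖x - 1‖ + B := add_le_add h1 h2
    _ ≤ C + B := by nlinarith

theorem integrableOn_expRem {s : ℂ} (hs : s.re < 1) : IntegrableOn (expRem s) (Ioc 0 1) := by
  obtain ⟨C, -, hC⟩ := exists_norm_expRem_le (isCompact_singleton (x := s)) (by simpa using hs)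
  refine (integrableOn_const (C := C) (by simp)).mono'
    (((continuousOn_expRem hs).mono Ioc_subset_Ioi_self).aestronglyMeasurable measurableSet_Ioc) ?_
  filter_upwards [ae_restrict_mem measurableSet_Ioc] with x hx using hC s rfl x hx

/-- The value at `x = 0` of the regular part of `expSum s x`, that is, the value at `s` of the
Riemann zeta function. -/
noncomputable def expRemZero (s : ℂ) : ℂ :=
  expRem s 1 + ∫ x in Ioc (0 : ℝ) 1, expRem (s - 1) x

theorem differentiableOn_expRemZero : DifferentiableOn ℂ expRemZero {s | s.re < 1} := by
  have hmap : MapsTo (fun s : ℂ => s - 1) {s : ℂ | s.re < 1} {s | s.re < 1} := fun s hs => by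
    simp only [mem_ofPred_eq, Complex.sub_re, Complex.one_re] at hs ⊢
    linarith
  refine (differentiableOn_expRem one_pos).add
    (differentiableOn_integral_of_dominated isOpen_re_lt_one (fun s hs => ?_) ?_
      fun K hKU hK => ?_)
  · exact (integrableOn_expRem (hmap hs)).aestronglyMeasurable
  · filter_upwards [ae_restrict_mem measurableSet_Ioc] with x hx
    exact (differentiableOn_expRem hx.1).comp
      (differentiableOn_id.sub_const 1 : DifferentiableOn ℂ (fun s : ℂ => s - 1) _) hmap
  · obtain ⟨C, -, hC⟩ := exists_norm_expRem_le (isCompact_image_sub_one hK)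
      ((image_mono hKU).trans hmap.image_subset)
    refine ⟨fun _ => C, integrableOn_const (by simp), ?_⟩
    filter_upwards [ae_restrict_mem measurableSet_Ioc] with x hx s hs
    exact hC _ (mem_image_of_mem _ hs) x hx

/-- By the fundamental theorem of calculus R_s(ε) = R_s(1) + ∫_ε^1 R_(s-1), and the integrand is
integrable down to 0. -/
theorem tendsto_expRem {s : ℂ} (hs : s.re < 1) :
    Tendsto (expRem s) (𝓝[>] 0) (𝓝 (expRemZero s)) := by
  have hs' : (s - 1).re < 1 := by
    rw [Complex.sub_re, Complex.one_re]
    linarith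
  have hI := (intervalIntegrable_iff_integrableOn_Ioc_of_le zero_le_one).2
    (integrableOn_expRem hs')
  have hcont := intervalIntegral.continuousOn_primitive_interval_left
    (f := expRem (s - 1)) (μ := volume) (a := 0) (b := 1) (by
      rw [uIcc_of_le zero_le_one]
      exact (integrableOn_Icc_iff_integrableOn_Ioc (by simp)).2 (integrableOn_expRem hs'))
  have h0 : Tendsto (fun ε : ℝ => ∫ x in ε..1, expRem (s - 1) x) (𝓝[>] 0)
      (𝓝 (∫ x in (0 : ℝ)..1, expRem (s - 1) x)) := by
    rw [uIcc_of_le zero_le_one] at hcont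
    refine (hcont 0 (left_mem_Icc.2 zero_le_one)).mono_left ?_
    rw [← nhdsWithin_Ioc_eq_nhdsGT (zero_lt_one : (0 : ℝ) < 1)]
    exact nhdsWithin_mono _ Ioc_subset_Icc_self
  rw [intervalIntegral.integral_of_le zero_le_one] at h0
  refine (h0.const_add (expRem s 1)).congr' ?_
  filter_upwards [Ioc_mem_nhdsGT (zero_lt_one : (0 : ℝ) < 1)] with ε hε
  have hFTC := intervalIntegral.integral_eq_sub_of_hasDerivAt (a := ε) (b := 1)
    (f := fun x => -expRem s x) (f' := expRem (s - 1)) (fun x hx => by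
      rw [uIcc_of_le hε.2] at hx
      simpa using (hasDerivAt_expRem hs (hε.1.trans_le hx.1)).fun_neg) (hI.mono_set (by
        rw [uIcc_of_le hε.2, uIcc_of_le zero_le_one]
        exact Icc_subset_Icc_left hε.1.le))
  rw [hFTC]
  ring

/-! ### Taylor expansion of the regular part -/

/-- The coefficients of the Taylor expansion of `expRem s x` at `x = 0`. -/
noncomputable def taylorCoeff (s : ℂ) (j : ℕ) : ℂ :=
  (-1) ^ j * expRemZero (s - j) / (j.factorial : ℂ)

/-- The remainder of the Taylor expansion of `expRem s x` at `x = 0`. -/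
noncomputable def taylorRem (N : ℕ) (s : ℂ) (x : ℝ) : ℂ :=
  expRem s x - ∑ j ∈ Finset.range N, taylorCoeff s j * (x : ℂ) ^ j

theorem succ_mul_taylorCoeff (s : ℂ) (j : ℕ) :
    taylorCoeff s (j + 1) * (j + 1) = -taylorCoeff (s - 1) j := by
  have hj : (j.factorial : ℂ) ≠ 0 := by exact_mod_cast j.factorial_ne_zero
  have hj1 : (j : ℂ) + 1 ≠ 0 := by exact_mod_cast j.succ_ne_zero
  rw [taylorCoeff, taylorCoeff, Nat.factorial_succ,
    show s - ((j + 1 : ℕ) : ℂ) = s - 1 - j by push_cast; ring]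
  push_cast
  field_simp
  ring

theorem differentiableOn_taylorCoeff (j : ℕ) :
    DifferentiableOn ℂ (fun s => taylorCoeff s j) {s | s.re < 1} := by
  refine DifferentiableOn.div_const (DifferentiableOn.const_mul ?_ _) _
  refine differentiableOn_expRemZero.comp
    (differentiableOn_id.sub_const (j : ℂ) : DifferentiableOn ℂ (fun s : ℂ => s - j) _)
    fun s hs => ?_
  simp only [mem_ofPred_eq, Complex.sub_re, Complex.natCast_re] at hs ⊢
  have : (0 : ℝ) ≤ j := j.cast_nonneg
  linarith

theorem differentiableOn_taylorRem (N : ℕ) {x : ℝ} (hx : 0 < x) :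
    DifferentiableOn ℂ (fun s => taylorRem N s x) {s | s.re < 1} :=
  (differentiableOn_expRem hx).sub (DifferentiableOn.fun_sum fun j _ =>
    (differentiableOn_taylorCoeff j).mul_const _)

theorem continuousOn_taylorRem (N : ℕ) {s : ℂ} (hs : s.re < 1) :
    ContinuousOn (taylorRem N s) (Ioi 0) :=
  (continuousOn_expRem hs).sub (by fun_prop)

theorem hasDerivAt_taylorRem_succ (N : ℕ) {s : ℂ} (hs : s.re < 1) {x : ℝ} (hx : 0 < x) :
    HasDerivAt (taylorRem (N + 1) s) (-taylorRem N (s - 1) x) x := by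
  have hpow : ∀ j : ℕ, HasDerivAt (fun y : ℝ => taylorCoeff s (j + 1) * (y : ℂ) ^ (j + 1))
      (-(taylorCoeff (s - 1) j * (x : ℂ) ^ j)) x := fun j => by
    have := ((hasDerivAt_pow (j + 1) (x : ℂ)).comp_ofReal).const_mul (taylorCoeff s (j + 1))
    refine this.congr_deriv ?_
    rw [← neg_mul, ← succ_mul_taylorCoeff]
    push_cast
    ring
  have h0 : HasDerivAt (fun y : ℝ => taylorCoeff s 0 * (y : ℂ) ^ 0) 0 x := by
    simpa using hasDerivAt_const x (taylorCoeff s 0)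
  have hsum := (HasDerivAt.fun_sum fun j (_ : j ∈ Finset.range N) => hpow j).add h0
  refine ((hasDerivAt_expRem hs hx).sub hsum).congr_deriv ?_ |>.congr_of_eventuallyEq
    (Eventually.of_forall fun y => ?_)
  · rw [taylorRem, Finset.sum_neg_distrib]
    ring
  · simp [taylorRem, Finset.sum_range_succ']

theorem tendsto_taylorRem_succ (N : ℕ) {s : ℂ} (hs : s.re < 1) :
    Tendsto (taylorRem (N + 1) s) (𝓝[>] 0) (𝓝 0) := by
  have hc : Continuous fun x : ℝ =>
      ∑ j ∈ Finset.range (N + 1), taylorCoeff s j * (x : ℂ) ^ j := by fun_prop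
  have h := (tendsto_expRem hs).sub ((hc.tendsto 0).mono_left nhdsWithin_le_nhds)
  have h0 : expRemZero s -
      ∑ j ∈ Finset.range (N + 1), taylorCoeff s j * ((0 : ℝ) : ℂ) ^ j = 0 := by
    simp [Finset.sum_range_succ', taylorCoeff]
  rw [h0] at h
  exact h

/-- Induction on `N`: the remainder of order N + 1 tends to 0 at 0 and has derivative minus the
remainder of order N at s - 1. The mean value inequality on [ε, x] followed by ε → 0 gains a factor
x. -/
theorem exists_norm_taylorRem_le (N : ℕ) {K : Set ℂ} (hK : IsCompact K)
    (hKU : K ⊆ {s | s.re < 1}) :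
    ∃ C : ℝ, 0 ≤ C ∧ ∀ s ∈ K, ∀ x ∈ Ioc (0 : ℝ) 1, ‖taylorRem N s x‖ ≤ C * x ^ N := by
  induction N generalizing K with
  | zero => simpa [taylorRem] using exists_norm_expRem_le hK hKU
  | succ N ih =>
    obtain ⟨C, hC0, hC⟩ := ih (isCompact_image_sub_one hK)
      ((image_sub_one_subset hKU).trans fun s hs => by
        simp only [mem_ofPred_eq] at hs ⊢
        linarith)
    refine ⟨C, hC0, fun s hs x hx => ?_⟩
    have hs1 : s.re < 1 := hKU hs
    have hlim : Tendsto (fun ε => ‖taylorRem (N + 1) s x - taylorRem (N + 1) s ε‖) (𝓝[>] 0)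
        (𝓝 ‖taylorRem (N + 1) s x‖) := by
      simpa using ((tendsto_taylorRem_succ N hs1).const_sub (taylorRem (N + 1) s x)).norm
    refine le_of_tendsto hlim ?_
    filter_upwards [Ioc_mem_nhdsGT hx.1] with ε hε
    have h := (convex_Icc ε x).norm_image_sub_le_of_norm_hasDerivWithin_le (C := C * x ^ N)
      (fun y hy => (hasDerivAt_taylorRem_succ N hs1 (hε.1.trans_le hy.1)).hasDerivWithinAt)
      (fun y hy => by
        have hy0 : 0 < y := hε.1.trans_le hy.1
        rw [norm_neg]
        refine (hC _ (mem_image_of_mem _ hs) y ⟨hy0, hy.2.trans hx.2⟩).trans ?_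
        gcongr
        exact hy.2)
      (left_mem_Icc.2 hε.2) (right_mem_Icc.2 hε.2)
    refine h.trans ?_
    rw [pow_succ, ← mul_assoc]
    have : 0 ≤ x := hx.1.le
    gcongr
    rw [Real.norm_eq_abs, abs_le]
    constructor <;> linarith [hε.1, hε.2]

/-! ### Nonvanishing at the relevant half-integers -/

theorem expRemZero_of_re_neg {s : ℂ} (hs : s.re < 0) :
    expRemZero s = Complex.Gamma (1 - s) * ∑' k : ℤ, lipschitzTerm s 0 k :=
  tendsto_nhds_unique (tendsto_expRem (hs.trans one_pos)) (tendsto_expRem_of_re_neg hs)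

theorem ofReal_mul_cpow {r : ℝ} (hr : 0 < r) {z : ℂ} (hz : z ≠ 0) (w : ℂ) :
    ((r : ℂ) * z) ^ w = (r : ℂ) ^ w * z ^ w := by
  have hr' : (r : ℂ) ≠ 0 := by exact_mod_cast hr.ne'
  rw [Complex.cpow_def_of_ne_zero (mul_ne_zero hr' hz), Complex.cpow_def_of_ne_zero hr',
    Complex.cpow_def_of_ne_zero hz, Complex.log_ofReal_mul hr hz, Complex.ofReal_log hr.le,
    add_mul, Complex.exp_add]

theorem I_cpow_add_neg_I_cpow (w : ℂ) :
    Complex.I ^ w + (-Complex.I) ^ w = 2 * Complex.cos (Real.pi / 2 * w) := by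
  rw [Complex.cpow_def_of_ne_zero Complex.I_ne_zero,
    Complex.cpow_def_of_ne_zero (neg_ne_zero.2 Complex.I_ne_zero), Complex.log_I,
    Complex.log_neg_I, Complex.two_cos]
  ring_nf

/-- Pairing the frequencies k and -k gives ∑ k^(s-1) times (2πi)^(s-1) + (-2πi)^(s-1). With
`expRemZero_of_re_neg` this is the functional equation of ζ. -/
theorem tsum_lipschitzTerm_zero {s : ℂ} (hs : s.re < 0) :
    ∑' k : ℤ, lipschitzTerm s 0 k = riemannZeta (1 - s) *
      (((2 * Real.pi : ℝ) : ℂ) ^ (s - 1) * (2 * Complex.cos (Real.pi / 2 * (s - 1)))) := by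
  have hI : (2 * Real.pi : ℝ) * Complex.I ≠ 0 :=
    mul_ne_zero (by exact_mod_cast Real.two_pi_pos.ne') Complex.I_ne_zero
  have hI' : (2 * Real.pi : ℝ) * -Complex.I ≠ 0 :=
    mul_ne_zero (by exact_mod_cast Real.two_pi_pos.ne') (neg_ne_zero.2 Complex.I_ne_zero)
  have hp : ∀ n : ℕ, lipschitzTerm s 0 ((n + 1 : ℕ) : ℤ) = 1 / ((n : ℂ) + 1) ^ (1 - s) *
      (((2 * Real.pi : ℝ) : ℂ) ^ (s - 1) * Complex.I ^ (s - 1)) := fun n => by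
    rw [lipschitzTerm, if_neg (by omega), ← ofReal_mul_cpow Real.two_pi_pos Complex.I_ne_zero,
      one_div, ← Complex.cpow_neg, neg_sub]
    have := ofReal_mul_cpow (r := (n : ℝ) + 1) (by positivity) hI (s - 1)
    push_cast at this ⊢
    rw [← this]
    congr 1
    ring
  have hm : ∀ n : ℕ, lipschitzTerm s 0 (-((n : ℤ) + 1)) = 1 / ((n : ℂ) + 1) ^ (1 - s) *
      (((2 * Real.pi : ℝ) : ℂ) ^ (s - 1) * (-Complex.I) ^ (s - 1)) := fun n => by
    rw [lipschitzTerm, if_neg (by omega),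
      ← ofReal_mul_cpow Real.two_pi_pos (neg_ne_zero.2 Complex.I_ne_zero),
      one_div, ← Complex.cpow_neg, neg_sub]
    have := ofReal_mul_cpow (r := (n : ℝ) + 1) (by positivity) hI' (s - 1)
    push_cast at this ⊢
    rw [← this]
    congr 1
    ring
  have hsum := summable_lipschitzTerm hs 0
  have h1 : Summable fun n : ℕ => lipschitzTerm s 0 (n : ℤ) :=
    hsum.comp_injective Nat.cast_injective
  have h2 : Summable fun n : ℕ => lipschitzTerm s 0 (-((n : ℤ) + 1)) :=
    hsum.comp_injective fun a b hab => by simpa using hab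
  rw [tsum_of_nat_of_neg_add_one h1 h2, h1.tsum_eq_zero_add]
  simp only [hp, hm, tsum_mul_right]
  rw [← zeta_eq_tsum_one_div_nat_add_one_cpow (by simp; linarith), ← I_cpow_add_neg_I_cpow]
  simp only [lipschitzTerm, Nat.cast_zero, if_true]
  ring

theorem expRemZero_half_sub_ne_zero_of_pos {k : ℕ} (hk : 0 < k) :
    expRemZero (1 / 2 - 3 * k) ≠ 0 := by
  have hk1 : (1 : ℝ) ≤ k := by exact_mod_cast hk
  have hs : (1 / 2 - 3 * (k : ℂ)).re < 0 := by
    simp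
    linarith
  rw [expRemZero_of_re_neg hs, tsum_lipschitzTerm_zero hs]
  refine mul_ne_zero (Complex.Gamma_ne_zero (one_sub_ne_neg_nat (by linarith)))
    (mul_ne_zero (riemannZeta_ne_zero_of_one_lt_re ?_)
      (mul_ne_zero ?_ (mul_ne_zero two_ne_zero ?_)))
  · rw [Complex.sub_re, Complex.one_re]
    linarith
  · rw [Ne, Complex.cpow_eq_zero_iff, not_and_or]
    exact Or.inl (by exact_mod_cast Real.two_pi_pos.ne')
  -- Here s - 1 = -(6k+1)/2, so a zero of the cosine would equate the odd number -1 - 6k with the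
  -- even number 2(2m+1).
  · intro h
    obtain ⟨m, hm⟩ := Complex.cos_eq_zero_iff.1 h
    have hpi : (Real.pi : ℂ) ≠ 0 := by exact_mod_cast Real.pi_ne_zero
    have h2 : (-1 - 6 * k : ℂ) = 2 * (2 * m + 1) := by
      apply mul_left_cancel₀ hpi
      linear_combination 4 * hm
    have h3 : (-1 - 6 * k : ℤ) = 2 * (2 * m + 1) := by exact_mod_cast h2
    omega

/-- With g(y) = y^(-1/2) e^(-xy) decreasing, the sum is at most g(1) + ∫_1^∞ g, while the subtracted
term is ∫_0^∞ g and ∫_0^1 g ≥ 2e^(-x). Letting x → 0 bounds ζ(1/2) by -1. -/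
theorem expRem_half_re_le {x : ℝ} (hx : 0 < x) : (expRem (1 / 2) x).re ≤ -Real.exp (-x) := by
  set g : ℝ → ℝ := fun y => y ^ (-(1 / 2) : ℝ) * Real.exp (-x * y) with hg
  have hgint : IntegrableOn g (Ioi 0) := integrableOn_rpow_mul_exp_neg_mul (by norm_num) hx
  have hganti : AntitoneOn g (Ioi 0) := by
    intro a ha b hb hab
    have ha0 : (0 : ℝ) < a := ha
    have hb0 : (0 : ℝ) < b := hb
    simp only [hg]
    gcongr ?_ * ?_
    · exact Real.rpow_le_rpow_of_nonpos ha0 hab (by norm_num)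
    · exact Real.exp_le_exp.2 (by nlinarith)
  have hgnn : ∀ y ∈ Ioi (0 : ℝ), 0 ≤ g y := fun y hy => by
    have : (0 : ℝ) < y := hy
    simp only [hg]
    positivity
  have hterm : ∀ n : ℕ+, ((n : ℕ) : ℂ) ^ (-(1 / 2) : ℂ) *
      Complex.exp (-(((n : ℕ) : ℂ) * x)) = ((g (n : ℕ) : ℝ) : ℂ) := fun n => by
    simp only [hg]
    rw [Complex.ofReal_mul, Complex.ofReal_cpow (by positivity), Complex.ofReal_exp]
    push_cast
    ring_nf
  have hL : expSum (1 / 2) x = ((∑' n : ℕ+, g (n : ℕ) : ℝ) : ℂ) := by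
    rw [expSum, Complex.ofReal_tsum]
    exact tsum_congr hterm
  have hsum : Summable fun n : ℕ => g ((n + 1 : ℕ) : ℝ) := by
    have h := summable_expSum (1 / 2) hx
    rw [← summable_pnat_iff_summable_succ (f := fun n : ℕ => g n)]
    refine h.congr fun n => ?_
    rw [hterm, Complex.norm_real, Real.norm_of_nonneg (hgnn _ (by simp))]
  have hGamma : Complex.Gamma (1 - 1 / 2) * (x : ℂ) ^ ((1 / 2 : ℂ) - 1) =
      ((∫ y in Ioi 0, g y : ℝ) : ℂ) := by
    have h := Real.integral_rpow_mul_exp_neg_mul_Ioi (a := 1 / 2) (by norm_num) hx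
    have hgeq : ∫ y in Ioi 0, g y = (1 / x) ^ (1 / 2 : ℝ) * Real.Gamma (1 / 2) := by
      rw [← h]
      refine setIntegral_congr_fun measurableSet_Ioi fun y _ => ?_
      simp only [hg]
      norm_num
    rw [hgeq, one_div x, Real.inv_rpow hx.le, ← Real.rpow_neg hx.le, Complex.ofReal_mul,
      Complex.ofReal_cpow hx.le, ← Complex.Gamma_ofReal, mul_comm]
    push_cast
    norm_num
  have hre : (expRem (1 / 2) x).re = ∑' n : ℕ+, g (n : ℕ) - ∫ y in Ioi 0, g y := by
    rw [expRem, hL, hGamma, ← Complex.ofReal_sub, Complex.ofReal_re]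
  have h1 : ∑' n : ℕ+, g (n : ℕ) ≤ Real.exp (-x) + ∫ y in Ioi 1, g y := by
    rw [tsum_pnat_eq_tsum_succ (f := fun n : ℕ => g n), hsum.tsum_eq_zero_add]
    have h := AntitoneOn.tsum_comp_add_le_integral (f := g) 1
      (hganti.mono fun y hy => lt_of_lt_of_le (show (0 : ℝ) < (1 : ℕ) by norm_num) hy)
      (hgint.mono_set (Ioi_subset_Ioi (by norm_num)))
      fun y hy => hgnn y (lt_trans (show (0 : ℝ) < (1 : ℕ) by norm_num) hy)
    have h0 : g ((0 + 1 : ℕ) : ℝ) = Real.exp (-x) := by simp [hg]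
    rw [h0]
    gcongr
    simpa using h
  have h2 : ∫ y in Ioi 0, g y = (∫ y in Ioc 0 1, g y) + ∫ y in Ioi 1, g y := by
    rw [← Ioc_union_Ioi_eq_Ioi (zero_le_one' ℝ), setIntegral_union
      (Ioc_disjoint_Ioi le_rfl) measurableSet_Ioi (hgint.mono_set Ioc_subset_Ioi_self)
      (hgint.mono_set (Ioi_subset_Ioi (by norm_num)))]
  have h3 : 2 * Real.exp (-x) ≤ ∫ y in Ioc 0 1, g y := by
    have hpow : ∫ y : ℝ in Ioc 0 1, y ^ (-(1 / 2) : ℝ) = 2 := by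
      rw [← intervalIntegral.integral_of_le zero_le_one, integral_rpow (Or.inl (by norm_num))]
      norm_num
    have hpint : IntegrableOn (fun y : ℝ => y ^ (-(1 / 2) : ℝ)) (Ioc 0 1) := by
      rw [← intervalIntegrable_iff_integrableOn_Ioc_of_le zero_le_one]
      exact intervalIntegral.intervalIntegrable_rpow' (by norm_num)
    rw [← hpow, ← integral_mul_const]
    refine setIntegral_mono_on (hpint.mul_const _) (hgint.mono_set Ioc_subset_Ioi_self)
      measurableSet_Ioc fun y hy => ?_
    have hy0 : 0 < y := hy.1
    simp only [hg]
    gcongr ?_ * ?_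
    exact Real.exp_le_exp.2 (by nlinarith [hy.2])
  rw [hre, h2]
  linarith

theorem expRemZero_half_ne_zero : expRemZero (1 / 2) ≠ 0 := by
  intro h
  have hlim := (Complex.continuous_re.tendsto _).comp
    (tendsto_expRem (s := 1 / 2) (by norm_num))
  have hexp : Tendsto (fun x : ℝ => -Real.exp (-x)) (𝓝[>] 0) (𝓝 (-Real.exp (-0))) :=
    (Continuous.tendsto (by fun_prop) 0).mono_left nhdsWithin_le_nhds
  have hle := le_of_tendsto_of_tendsto hlim hexp (by
    filter_upwards [self_mem_nhdsWithin] with x hx using expRem_half_re_le hx)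
  rw [h] at hle
  simp at hle
  linarith

theorem expRemZero_half_sub_ne_zero (k : ℕ) : expRemZero (1 / 2 - 3 * k) ≠ 0 := by
  rcases Nat.eq_zero_or_pos k with rfl | hk
  · simpa using expRemZero_half_ne_zero
  · exact expRemZero_half_sub_ne_zero_of_pos hk

/-! ### Mellin transforms over the unit interval -/

theorem integrableOn_cpow_Ioc {w : ℂ} (hw : 0 < w.re) :
    IntegrableOn (fun x : ℝ => (x : ℂ) ^ (w - 1)) (Ioc 0 1) := by
  rw [← intervalIntegrable_iff_integrableOn_Ioc_of_le zero_le_one]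
  exact intervalIntegral.intervalIntegrable_cpow' (by simpa using hw)

theorem integral_cpow_Ioc {w : ℂ} (hw : 0 < w.re) :
    ∫ x : ℝ in Ioc 0 1, (x : ℂ) ^ (w - 1) = 1 / w := by
  have hw0 : w ≠ 0 := by
    rintro rfl
    simp at hw
  rw [← intervalIntegral.integral_of_le zero_le_one, integral_cpow (Or.inl (by simpa using hw))]
  simp [hw0]

/-- `H` is a family of functions on `(0, 1]`, holomorphic in `s ∈ U`, which is `O(x ^ N)` locally
uniformly in `s`. -/
structure IsHolomorphicFamily (U : Set ℂ) (N : ℕ) (H : ℂ → ℝ → ℂ) : Prop where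
  differentiableOn : ∀ x : ℝ, 0 < x → DifferentiableOn ℂ (fun s => H s x) U
  continuousOn : ∀ s ∈ U, ContinuousOn (H s) (Ioi 0)
  bound : ∀ K ⊆ U, IsCompact K →
    ∃ C : ℝ, 0 ≤ C ∧ ∀ s ∈ K, ∀ x ∈ Ioc (0 : ℝ) 1, ‖H s x‖ ≤ C * x ^ N

namespace IsHolomorphicFamily

variable {U : Set ℂ} {N : ℕ} {H : ℂ → ℝ → ℂ}

theorem aestronglyMeasurable (h : IsHolomorphicFamily U N H) {s : ℂ} (hs : s ∈ U) (w : ℂ) :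
    AEStronglyMeasurable (fun x : ℝ => (x : ℂ) ^ (w - 1) * H s x) (volume.restrict (Ioc 0 1)) :=
  (((continuousOn_ofReal_cpow _).mul (h.continuousOn s hs)).mono
    Ioc_subset_Ioi_self).aestronglyMeasurable measurableSet_Ioc

theorem exists_bound_mellin (h : IsHolomorphicFamily U N H) {w : ℂ → ℂ} {K : Set ℂ}
    (hK : IsCompact K)
    (hKU : K ⊆ {s | s ∈ U ∧ -(N : ℝ) < (w s).re}) (hw : ContinuousOn w K) :
    ∃ g : ℝ → ℝ, IntegrableOn g (Ioc 0 1) ∧ ∀ s ∈ K, ∀ x ∈ Ioc (0 : ℝ) 1,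
      ‖(x : ℂ) ^ (w s - 1) * H s x‖ ≤ g x := by
  rcases K.eq_empty_or_nonempty with rfl | hne
  · exact ⟨fun _ => 0, integrable_zero _ _ _, by simp⟩
  -- On (0, 1] the smallest exponent dominates, so the point of `K` minimising Re w supplies the
  -- bound.
  obtain ⟨z, hz, hmin⟩ := hK.exists_isMinOn hne (Complex.continuous_re.comp_continuousOn hw)
  obtain ⟨C, hC0, hC⟩ := h.bound K (fun s hs => (hKU hs).1) hK
  have hzN : -(N : ℝ) < (w z).re := (hKU hz).2
  refine ⟨fun x => C * x ^ ((w z).re + N - 1), ?_, fun s hs x hx => ?_⟩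
  · have hint : IntegrableOn (fun x : ℝ => x ^ ((w z).re + N - 1)) (Ioc 0 1) := by
      rw [← intervalIntegrable_iff_integrableOn_Ioc_of_le zero_le_one]
      exact intervalIntegral.intervalIntegrable_rpow' (by linarith)
    exact hint.const_mul C
  · have hle : (w z).re ≤ (w s).re := hmin hs
    have hx0 : 0 < x := hx.1
    rw [norm_mul, Complex.norm_cpow_eq_rpow_re_of_pos hx0, Complex.sub_re, Complex.one_re]
    calc x ^ ((w s).re - 1) * ‖H s x‖ ≤ x ^ ((w s).re - 1) * (C * x ^ N) := by
          gcongr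
          exact hC s hs x hx
      _ = C * x ^ ((w s).re + N - 1) := by
          rw [show (w s).re + N - 1 = ((w s).re - 1) + N by ring, Real.rpow_add hx0,
            Real.rpow_natCast]
          ring
      _ ≤ C * x ^ ((w z).re + N - 1) :=
          mul_le_mul_of_nonneg_left
            (Real.rpow_le_rpow_of_exponent_ge hx0 hx.2 (by linarith)) hC0

theorem integrableOn_mellin (h : IsHolomorphicFamily U N H) {s w : ℂ} (hs : s ∈ U)
    (hw : -(N : ℝ) < w.re) : IntegrableOn (fun x : ℝ => (x : ℂ) ^ (w - 1) * H s x) (Ioc 0 1) := by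
  obtain ⟨g, hg, hb⟩ := h.exists_bound_mellin (w := fun _ => w) (isCompact_singleton (x := s))
    (by simpa using ⟨hs, hw⟩) continuousOn_const
  refine hg.mono' (h.aestronglyMeasurable hs w) ?_
  filter_upwards [ae_restrict_mem measurableSet_Ioc] with x hx using hb s rfl x hx

theorem differentiableOn_mellin (h : IsHolomorphicFamily U N H) (hU : IsOpen U) {w : ℂ → ℂ}
    (hw : Differentiable ℂ w) :
    DifferentiableOn ℂ (fun s => ∫ x : ℝ in Ioc 0 1, (x : ℂ) ^ (w s - 1) * H s x)
      {s | s ∈ U ∧ -(N : ℝ) < (w s).re} := by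
  refine differentiableOn_integral_of_dominated (hU.inter (isOpen_lt continuous_const
    (Complex.continuous_re.comp hw.continuous))) (fun s hs => h.aestronglyMeasurable hs.1 _) ?_
    fun K hKU hK => ?_
  · filter_upwards [ae_restrict_mem measurableSet_Ioc] with x hx
    have hx0 : (x : ℂ) ≠ 0 := by exact_mod_cast hx.1.ne'
    refine DifferentiableOn.mul (fun s _ => ?_)
      ((h.differentiableOn x hx.1).mono fun s hs => hs.1)
    exact (((hw s).sub_const 1).const_cpow (Or.inl hx0)).differentiableWithinAt
  · obtain ⟨g, hg, hb⟩ := h.exists_bound_mellin hK hKU hw.continuous.continuousOn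
    refine ⟨g, hg, ?_⟩
    filter_upwards [ae_restrict_mem measurableSet_Ioc] with x hx s hs using hb s hs x hx

end IsHolomorphicFamily

/-- Each monomial integrates to one polar term, ∫_0^1 x^(w-1+e) dx = 1/(w+e). -/
theorem integral_cpow_mul_sum_add {ι : Type*} (t : Finset ι) (c : ι → ℂ) (e : ι → ℕ) {R : ℝ → ℂ}
    {w : ℂ} (hw : 0 < w.re)
    (hR : IntegrableOn (fun x : ℝ => (x : ℂ) ^ (w - 1) * R x) (Ioc 0 1)) :
    ∫ x : ℝ in Ioc 0 1, (x : ℂ) ^ (w - 1) * (∑ i ∈ t, c i * (x : ℂ) ^ e i + R x) =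
      ∑ i ∈ t, c i / (w + e i) + ∫ x : ℝ in Ioc 0 1, (x : ℂ) ^ (w - 1) * R x := by
  have hwi : ∀ i, 0 < (w + (e i : ℂ)).re := fun i => by
    rw [Complex.add_re, Complex.natCast_re]
    positivity
  have hcongr : EqOn (fun x : ℝ => (x : ℂ) ^ (w - 1) * (∑ i ∈ t, c i * (x : ℂ) ^ e i + R x))
      (fun x : ℝ => ∑ i ∈ t, c i * (x : ℂ) ^ (w + e i - 1) + (x : ℂ) ^ (w - 1) * R x)
      (Ioc 0 1) := fun x hx => by
    have hx0 : (x : ℂ) ≠ 0 := by exact_mod_cast hx.1.ne'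
    simp only [mul_add, Finset.mul_sum]
    congr 1
    refine Finset.sum_congr rfl fun i _ => ?_
    rw [show w + e i - 1 = (w - 1) + e i by ring, Complex.cpow_add _ _ hx0, Complex.cpow_natCast]
    ring
  have hint : ∀ i ∈ t, Integrable (fun x : ℝ => c i * (x : ℂ) ^ (w + e i - 1))
      (volume.restrict (Ioc 0 1)) := fun i _ => (integrableOn_cpow_Ioc (hwi i)).const_mul _
  rw [setIntegral_congr_fun measurableSet_Ioc hcongr,
    integral_add (integrable_finsetSum t hint) hR, integral_finsetSum t hint]
  congr 1
  refine Finset.sum_congr rfl fun i _ => ?_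
  rw [integral_const_mul, integral_cpow_Ioc (hwi i), mul_one_div]

/-! ### The families appearing in the expansion -/

theorem isHolomorphicFamily_taylorRem (N : ℕ) :
    IsHolomorphicFamily {s | s.re < 1} N (taylorRem N) where
  differentiableOn _ hx := differentiableOn_taylorRem N hx
  continuousOn _ hs := continuousOn_taylorRem N hs
  bound _ hKU hK := exists_norm_taylorRem_le N hK hKU

/-- The remainder of the Taylor expansion of `(expRem s x) ^ 2` at `x = 0`. -/
noncomputable def sqRem (N : ℕ) (s : ℂ) (x : ℝ) : ℂ :=
  taylorRem N s x * (2 * expRem s x - taylorRem N s x)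

theorem isHolomorphicFamily_sqRem (N : ℕ) :
    IsHolomorphicFamily {s | s.re < 1} N (sqRem N) where
  differentiableOn _ hx := (differentiableOn_taylorRem N hx).mul
    (((differentiableOn_expRem hx).const_mul 2).sub (differentiableOn_taylorRem N hx))
  continuousOn _ hs := (continuousOn_taylorRem N hs).mul
    ((continuousOn_const.mul (continuousOn_expRem hs)).sub (continuousOn_taylorRem N hs))
  bound K hKU hK := by
    obtain ⟨C, hC0, hC⟩ := exists_norm_taylorRem_le N hK hKU
    obtain ⟨B, hB0, hB⟩ := exists_norm_expRem_le hK hKU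
    refine ⟨C * (2 * B + C), by positivity, fun s hs x hx => ?_⟩
    have h1 : ‖2 * expRem s x - taylorRem N s x‖ ≤ 2 * B + C := by
      refine (norm_sub_le _ _).trans (add_le_add ?_ ((hC s hs x hx).trans ?_))
      · rw [norm_mul, Complex.norm_ofNat]
        gcongr
        exact hB s hs x hx
      · exact mul_le_of_le_one_right hC0 (pow_le_one₀ hx.1.le hx.2)
    have hx0 : 0 < x := hx.1
    calc ‖sqRem N s x‖ = ‖taylorRem N s x‖ * ‖2 * expRem s x - taylorRem N s x‖ := norm_mul _ _
      _ ≤ C * x ^ N * (2 * B + C) := by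
          gcongr
          exact hC s hs x hx
      _ = _ := by ring

theorem expRem_eq_sum_add (N : ℕ) (s : ℂ) (x : ℝ) :
    expRem s x = ∑ j ∈ Finset.range N, taylorCoeff s j * (x : ℂ) ^ j + taylorRem N s x := by
  rw [taylorRem]
  ring

/-- If R = P + r with P the Taylor polynomial, then R^2 = P^2 + r(2R - r). Keeping all of P^2,
without truncating it, leaves a factor r in the remainder, hence O(x^N). -/
theorem expRem_sq_eq_sum_add (N : ℕ) (s : ℂ) (x : ℝ) :
    expRem s x ^ 2 = ∑ p ∈ Finset.range N ×ˢ Finset.range N,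
      taylorCoeff s p.1 * taylorCoeff s p.2 * (x : ℂ) ^ (p.1 + p.2) + sqRem N s x := by
  have h : ∑ p ∈ Finset.range N ×ˢ Finset.range N,
      taylorCoeff s p.1 * taylorCoeff s p.2 * (x : ℂ) ^ (p.1 + p.2) =
      (∑ j ∈ Finset.range N, taylorCoeff s j * (x : ℂ) ^ j) ^ 2 := by
    rw [sq, Finset.sum_mul_sum, ← Finset.sum_product']
    exact Finset.sum_congr rfl fun p _ => by ring
  rw [h, sqRem, taylorRem]
  ring

/-! ### The tail of the Mellin transform -/

theorem exists_bound_tail {K : Set ℂ} (hK : IsCompact K) :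
    ∃ g : ℝ → ℝ, IntegrableOn g (Ioi 1) ∧ ∀ s ∈ K, ∀ x ∈ Ioi (1 : ℝ),
      ‖(x : ℂ) ^ (s - 1) * expSum s x ^ 2‖ ≤ g x := by
  obtain ⟨C, hC⟩ := exists_norm_expSum_le hK
  obtain ⟨b, hb⟩ := (hK.image Complex.continuous_re).bddAbove
  refine ⟨fun x => C ^ 2 * (x ^ (max b 0) * Real.exp (-2 * x)), ?_, fun s hs x hx => ?_⟩
  · refine Integrable.const_mul (IntegrableOn.mono_set (integrableOn_rpow_mul_exp_neg_mul
      (lt_max_of_lt_right (by norm_num)) two_pos) (Ioi_subset_Ioi zero_le_one)) _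
  · have hx1 : (1 : ℝ) < x := hx
    have hx0 : 0 < x := one_pos.trans hx1
    have hsb : s.re ≤ b := hb (mem_image_of_mem _ hs)
    have h1 : x ^ (s - 1).re ≤ x ^ (max b 0) := by
      refine Real.rpow_le_rpow_of_exponent_le hx1.le ?_
      rw [Complex.sub_re, Complex.one_re]
      linarith [le_max_left b 0]
    rw [norm_mul, norm_pow, Complex.norm_cpow_eq_rpow_re_of_pos hx0]
    calc x ^ (s - 1).re * ‖expSum s x‖ ^ 2
        ≤ x ^ (max b 0) * (C * Real.exp (-x)) ^ 2 := by
          gcongr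
          exact hC s hs x hx1.le
      _ = _ := by
          rw [mul_pow, ← Real.exp_nat_mul]
          push_cast
          ring_nf

theorem aestronglyMeasurable_tail (s : ℂ) :
    AEStronglyMeasurable (fun x : ℝ => (x : ℂ) ^ (s - 1) * expSum s x ^ 2)
      (volume.restrict (Ioi 1)) :=
  (((continuousOn_ofReal_cpow _).mul ((continuousOn_expSum s).pow 2)).mono
    (Ioi_subset_Ioi zero_le_one)).aestronglyMeasurable measurableSet_Ioi

theorem integrableOn_tail (s : ℂ) :
    IntegrableOn (fun x : ℝ => (x : ℂ) ^ (s - 1) * expSum s x ^ 2) (Ioi 1) := by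
  obtain ⟨g, hg, hb⟩ := exists_bound_tail (isCompact_singleton (x := s))
  refine hg.mono' (aestronglyMeasurable_tail s) ?_
  filter_upwards [ae_restrict_mem measurableSet_Ioi] with x hx using hb s rfl x hx

theorem differentiable_tail :
    Differentiable ℂ fun s => ∫ x : ℝ in Ioi 1, (x : ℂ) ^ (s - 1) * expSum s x ^ 2 := by
  rw [← differentiableOn_univ]
  refine differentiableOn_integral_of_dominated isOpen_univ
    (fun s _ => aestronglyMeasurable_tail s) ?_ fun K _ hK => ?_
  · filter_upwards [ae_restrict_mem measurableSet_Ioi] with x hx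
    have hx1 : (0 : ℝ) < x := one_pos.trans hx
    have hx0 : (x : ℂ) ≠ 0 := by exact_mod_cast hx1.ne'
    intro s _
    exact (((differentiableAt_id.sub_const 1).const_cpow (Or.inl hx0)).mul
      ((differentiable_expSum hx1 s).pow 2)).differentiableWithinAt
  · obtain ⟨g, hg, hb⟩ := exists_bound_tail hK
    refine ⟨g, hg, ?_⟩
    filter_upwards [ae_restrict_mem measurableSet_Ioi] with x hx s hs using hb s hs x hx

/-! ### The diagonal double series -/

theorem mem_convergenceRegion_diag {s : ℂ} : (s, s, s) ∈ convergenceRegion ↔ 2 / 3 < s.re := by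
  simp only [convergenceRegion, mem_ofPred_eq, Complex.add_re]
  constructor
  · rintro ⟨-, -, h⟩
    linarith
  · intro h
    refine ⟨?_, ?_, ?_⟩ <;> linarith

theorem norm_term_diag (s : ℂ) (p : ℕ+ × ℕ+) :
    ‖term s s s p‖ = ((p.1 : ℕ) : ℝ) ^ (-s.re) * ((p.2 : ℕ) : ℝ) ^ (-s.re) *
      (((p.1 : ℕ) : ℝ) + (p.2 : ℕ)) ^ (-s.re) := by
  have h3 : (((p.1 : ℕ) : ℂ) + ((p.2 : ℕ) : ℂ)) = (((p.1 + p.2 : ℕ+) : ℕ) : ℂ) := by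
    push_cast
    rfl
  rw [term, h3, norm_div, norm_mul, norm_mul, norm_one,
    Complex.norm_natCast_cpow_of_pos p.1.pos, Complex.norm_natCast_cpow_of_pos p.2.pos,
    Complex.norm_natCast_cpow_of_pos (p.1 + p.2).pos, PNat.add_coe, Nat.cast_add,
    Real.rpow_neg (by positivity), Real.rpow_neg (by positivity), Real.rpow_neg (by positivity),
    one_div, mul_inv, mul_inv]

/-- Since √(mn) ≤ m + n, the term is at most (mn)^(-3σ/2), which separates the variables and is
summable exactly for σ > 2/3. -/
theorem norm_term_diag_le {s : ℂ} {σ : ℝ} (hσ : 0 < σ) (hs : σ ≤ s.re) (p : ℕ+ × ℕ+) :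
    ‖term s s s p‖ ≤
      ((p.1 : ℕ) : ℝ) ^ (-(3 / 2 * σ)) * ((p.2 : ℕ) : ℝ) ^ (-(3 / 2 * σ)) := by
  have hm : (1 : ℝ) ≤ (p.1 : ℕ) := by exact_mod_cast (one_le : 1 ≤ p.1)
  have hn : (1 : ℝ) ≤ (p.2 : ℕ) := by exact_mod_cast (one_le : 1 ≤ p.2)
  rw [norm_term_diag]
  set m : ℝ := ((p.1 : ℕ) : ℝ)
  set n : ℝ := ((p.2 : ℕ) : ℝ)
  have hm0 : 0 < m := by linarith
  have hn0 : 0 < n := by linarith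
  have hmn : (m * n) ^ (1 / 2 : ℝ) ≤ m + n := by
    rw [← Real.sqrt_eq_rpow]
    refine Real.sqrt_le_iff.2 ⟨by positivity, by nlinarith⟩
  have h3 : (m + n) ^ (-s.re) ≤ m ^ (-(1 / 2 * σ)) * n ^ (-(1 / 2 * σ)) := by
    calc (m + n) ^ (-s.re) ≤ (m + n) ^ (-σ) :=
          Real.rpow_le_rpow_of_exponent_le (by linarith) (by linarith)
      _ ≤ ((m * n) ^ (1 / 2 : ℝ)) ^ (-σ) :=
          Real.rpow_le_rpow_of_nonpos (by positivity) hmn (by linarith)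
      _ = _ := by
          rw [← Real.rpow_mul (by positivity), Real.mul_rpow hm0.le hn0.le]
          ring_nf
  calc m ^ (-s.re) * n ^ (-s.re) * (m + n) ^ (-s.re)
      ≤ m ^ (-σ) * n ^ (-σ) * (m ^ (-(1 / 2 * σ)) * n ^ (-(1 / 2 * σ))) := by
        gcongr
    _ = (m ^ (-σ) * m ^ (-(1 / 2 * σ))) * (n ^ (-σ) * n ^ (-(1 / 2 * σ))) := by ring
    _ = _ := by
        rw [← Real.rpow_add hm0, ← Real.rpow_add hn0]
        ring_nf

theorem summable_term_bound {σ : ℝ} (hσ : 2 / 3 < σ) :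
    Summable fun p : ℕ+ × ℕ+ =>
      ((p.1 : ℕ) : ℝ) ^ (-(3 / 2 * σ)) * ((p.2 : ℕ) : ℝ) ^ (-(3 / 2 * σ)) := by
  have h : Summable fun n : ℕ+ => ((n : ℕ) : ℝ) ^ (-(3 / 2 * σ)) :=
    (Real.summable_nat_rpow.2 (by linarith)).comp_injective PNat.coe_injective
  exact h.mul_of_nonneg h (fun _ => by positivity) fun _ => by positivity

theorem summable_norm_term {s : ℂ} (hs : 2 / 3 < s.re) : Summable fun p => ‖term s s s p‖ :=
  (summable_term_bound hs).of_nonneg_of_le (fun _ => norm_nonneg _)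
    (norm_term_diag_le (by linarith) le_rfl)

/-- The sum of the diagonal double series. -/
noncomputable def diagSum (s : ℂ) : ℂ :=
  ∑' p, term s s s p

theorem hasSum_diagSum {s : ℂ} (hs : 2 / 3 < s.re) : HasSum (term s s s) (diagSum s) :=
  (summable_norm_term hs).of_norm.hasSum

theorem isOpen_two_thirds_lt_re : IsOpen {s : ℂ | 2 / 3 < s.re} :=
  isOpen_lt continuous_const Complex.continuous_re

theorem differentiable_term (p : ℕ+ × ℕ+) : Differentiable ℂ fun s => term s s s p := by
  intro s
  have h1 : ((p.1 : ℕ) : ℂ) ≠ 0 := by exact_mod_cast p.1.ne_zero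
  have h2 : ((p.2 : ℕ) : ℂ) ≠ 0 := by exact_mod_cast p.2.ne_zero
  have h3 : ((p.1 : ℕ) : ℂ) + ((p.2 : ℕ) : ℂ) ≠ 0 := by exact_mod_cast (p.1 + p.2).ne_zero
  refine (differentiableAt_const _).div (((differentiableAt_id.const_cpow (Or.inl h1)).mul
    (differentiableAt_id.const_cpow (Or.inl h2))).mul (differentiableAt_id.const_cpow (Or.inl h3)))
    ?_
  simp [Complex.cpow_eq_zero_iff, h1, h2, h3]

theorem differentiableOn_diagSum : DifferentiableOn ℂ diagSum {s | 2 / 3 < s.re} := by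
  intro s hs
  obtain ⟨σ, hσ, hσs⟩ := exists_between (show 2 / 3 < s.re from hs)
  have hU : IsOpen {s : ℂ | σ < s.re} := isOpen_lt continuous_const Complex.continuous_re
  refine ((Complex.differentiableOn_tsum_of_summable_norm (summable_term_bound hσ)
    (fun p => (differentiable_term p).differentiableOn) hU fun p w hw =>
      norm_term_diag_le (by linarith) (le_of_lt hw) p).differentiableAt
    (hU.mem_nhds hσs)).differentiableWithinAt

theorem analyticAt_diagSum {s : ℂ} (hs : 2 / 3 < s.re) : AnalyticAt ℂ diagSum s :=
  differentiableOn_diagSum.analyticAt (isOpen_two_thirds_lt_re.mem_nhds hs)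

/-- The product of two terms of the series `expSum s x`, times `x ^ (s - 1)`. -/
noncomputable def mellinTerm (s : ℂ) (p : ℕ+ × ℕ+) (x : ℝ) : ℂ :=
  (x : ℂ) ^ (s - 1) * ((((p.1 : ℕ) : ℂ) ^ (-s) * Complex.exp (-(((p.1 : ℕ) : ℂ) * x))) *
    (((p.2 : ℕ) : ℂ) ^ (-s) * Complex.exp (-(((p.2 : ℕ) : ℂ) * x))))

theorem mellinTerm_eq (s : ℂ) (p : ℕ+ × ℕ+) (x : ℝ) :
    mellinTerm s p x = ((p.1 : ℕ) : ℂ) ^ (-s) * ((p.2 : ℕ) : ℂ) ^ (-s) *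
      ((x : ℂ) ^ (s - 1) * Complex.exp (-((((p.1 : ℕ) : ℂ) + ((p.2 : ℕ) : ℂ)) * x))) := by
  rw [mellinTerm, add_mul, neg_add, Complex.exp_add]
  ring

theorem norm_mellinTerm (s : ℂ) (p : ℕ+ × ℕ+) {x : ℝ} (hx : 0 < x) :
    ‖mellinTerm s p x‖ = ((p.1 : ℕ) : ℝ) ^ (-s.re) * ((p.2 : ℕ) : ℝ) ^ (-s.re) *
      (x ^ (s.re - 1) * Real.exp (-((((p.1 : ℕ) : ℝ) + (p.2 : ℕ)) * x))) := by
  rw [mellinTerm_eq, norm_mul, norm_mul, norm_cpow_mul_exp hx,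
    Complex.norm_natCast_cpow_of_pos p.1.pos, Complex.norm_natCast_cpow_of_pos p.2.pos,
    Complex.add_re, Complex.natCast_re, Complex.natCast_re, neg_mul, Complex.neg_re]

theorem integrableOn_mellinTerm {s : ℂ} (hs : 0 < s.re) (p : ℕ+ × ℕ+) :
    IntegrableOn (mellinTerm s p) (Ioi 0) := by
  have hpos : (0 : ℝ) < ((p.1 : ℕ) : ℝ) + (p.2 : ℕ) := by exact_mod_cast (p.1 + p.2).pos
  refine ((integrableOn_rpow_mul_exp_neg_mul (a := s.re - 1) (by linarith) hpos).const_mul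
    (((p.1 : ℕ) : ℝ) ^ (-s.re) * ((p.2 : ℕ) : ℝ) ^ (-s.re))).mono' ?_ ?_
  · refine ContinuousOn.aestronglyMeasurable ?_ measurableSet_Ioi
    exact (continuousOn_ofReal_cpow _).mul (by fun_prop)
  · filter_upwards [ae_restrict_mem measurableSet_Ioi] with x hx
    rw [norm_mellinTerm s p hx, neg_mul]

theorem integral_norm_mellinTerm {s : ℂ} (hs : 0 < s.re) (p : ℕ+ × ℕ+) :
    ∫ x in Ioi 0, ‖mellinTerm s p x‖ = ‖term s s s p‖ * Real.Gamma s.re := by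
  have hpos : (0 : ℝ) < ((p.1 : ℕ) : ℝ) + (p.2 : ℕ) := by exact_mod_cast (p.1 + p.2).pos
  rw [setIntegral_congr_fun measurableSet_Ioi fun x hx => norm_mellinTerm s p hx,
    integral_const_mul, Real.integral_rpow_mul_exp_neg_mul_Ioi hs hpos, norm_term_diag, one_div,
    Real.inv_rpow hpos.le, ← Real.rpow_neg hpos.le]
  ring

theorem integral_mellinTerm {s : ℂ} (hs : 0 < s.re) (p : ℕ+ × ℕ+) :
    ∫ x in Ioi 0, mellinTerm s p x = Complex.Gamma s * term s s s p := by
  have hpos : 0 < (((p.1 : ℕ) : ℂ) + ((p.2 : ℕ) : ℂ)).re := by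
    simp only [Complex.add_re, Complex.natCast_re]
    exact_mod_cast (p.1 + p.2).pos
  simp only [mellinTerm_eq]
  rw [integral_const_mul, integral_cpow_mul_exp_neg_complex_mul_Ioi hs hpos, term,
    Complex.cpow_neg, Complex.cpow_neg, Complex.cpow_neg, one_div, mul_inv, mul_inv]
  ring

theorem tsum_mellinTerm (s : ℂ) {x : ℝ} (hx : 0 < x) :
    ∑' p, mellinTerm s p x = (x : ℂ) ^ (s - 1) * expSum s x ^ 2 := by
  simp only [mellinTerm, tsum_mul_left]
  rw [sq, expSum, tsum_mul_tsum_of_summable_norm (summable_expSum s hx) (summable_expSum s hx)]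

/-- The interchange of sum and integral is legitimate because the integrals of the norms add up to
Γ(Re s) ∑ ‖term‖. -/
theorem Gamma_mul_diagSum {s : ℂ} (hs : 2 / 3 < s.re) :
    Complex.Gamma s * diagSum s = ∫ x : ℝ in Ioi 0, (x : ℂ) ^ (s - 1) * expSum s x ^ 2 := by
  have hs0 : 0 < s.re := by linarith
  have h := hasSum_integral_of_summable_integral_norm (F := mellinTerm s)
    (integrableOn_mellinTerm hs0) (by
      simp only [integral_norm_mellinTerm hs0]
      exact (summable_norm_term hs).mul_right _)
  simp only [integral_mellinTerm hs0] at h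
  rw [setIntegral_congr_fun measurableSet_Ioi fun x hx => tsum_mellinTerm s hx] at h
  exact ((hasSum_diagSum hs).mul_left _).unique h

/-! ### The expansion of the Mellin transform -/

/-- The Mellin transform of `expSum s x ^ 2` at `s`, continued to a half plane that grows
with `N`. -/
noncomputable def mellinExpansion (N : ℕ) (s : ℂ) : ℂ :=
  (∫ x : ℝ in Ioi 1, (x : ℂ) ^ (s - 1) * expSum s x ^ 2) +
    Complex.Gamma (1 - s) ^ 2 / (3 * s + -2) +
    2 * Complex.Gamma (1 - s) * (∑ j ∈ Finset.range N, taylorCoeff s j / (2 * s + (-1 + j)) +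
      ∫ x : ℝ in Ioc 0 1, (x : ℂ) ^ ((2 * s - 1) - 1) * taylorRem N s x) +
    (∑ p ∈ Finset.range N ×ˢ Finset.range N,
      taylorCoeff s p.1 * taylorCoeff s p.2 / (1 * s + (p.1 + p.2 : ℕ)) +
      ∫ x : ℝ in Ioc 0 1, (x : ℂ) ^ (s - 1) * sqRem N s x)

theorem cpow_mul_expSum_sq (s : ℂ) {x : ℝ} (hx : 0 < x) :
    (x : ℂ) ^ (s - 1) * expSum s x ^ 2 =
      Complex.Gamma (1 - s) ^ 2 * (x : ℂ) ^ ((3 * s - 2) - 1) +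
        2 * Complex.Gamma (1 - s) * ((x : ℂ) ^ ((2 * s - 1) - 1) * expRem s x) +
        (x : ℂ) ^ (s - 1) * expRem s x ^ 2 := by
  have hx0 : (x : ℂ) ≠ 0 := by exact_mod_cast hx.ne'
  have h1 : expSum s x = expRem s x + Complex.Gamma (1 - s) * (x : ℂ) ^ (s - 1) := by
    rw [expRem]
    ring
  rw [h1, show (3 * s - 2) - 1 = (s - 1) + (s - 1) + (s - 1) by ring,
    show (2 * s - 1) - 1 = (s - 1) + (s - 1) by ring, Complex.cpow_add _ _ hx0,
    Complex.cpow_add _ _ hx0]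
  ring

theorem Gamma_mul_diagSum_eq_mellinExpansion (N : ℕ) {s : ℂ} (hs : 2 / 3 < s.re)
    (hs1 : s.re < 1) : Complex.Gamma s * diagSum s = mellinExpansion N s := by
  have hw3 : 0 < (3 * s - 2).re := by
    simp
    linarith
  have hw2 : 0 < (2 * s - 1).re := by
    simp
    linarith
  have hw1 : 0 < s.re := by linarith
  have hN : -(N : ℝ) ≤ 0 := by simp
  have hI3 := (integrableOn_cpow_Ioc hw3).const_mul (Complex.Gamma (1 - s) ^ 2)
  -- For `N = 0` the remainders are `expRem` and its square, so these give integrability of the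
  -- unexpanded pieces.
  have hI2 := ((isHolomorphicFamily_taylorRem 0).integrableOn_mellin hs1 (w := 2 * s - 1)
    (by simpa using hw2)).const_mul (2 * Complex.Gamma (1 - s))
  have hI1 := (isHolomorphicFamily_sqRem 0).integrableOn_mellin hs1 (w := s) (by simpa using hw1)
  have hrem0 : taylorRem 0 s = expRem s := by
    funext x
    simp [taylorRem]
  have hsq0 : sqRem 0 s = fun x => expRem s x ^ 2 := by
    funext x
    rw [expRem_sq_eq_sum_add 0]
    simp
  rw [hrem0] at hI2
  rw [hsq0] at hI1
  beta_reduce at hI1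
  have hI23 : IntegrableOn (fun x : ℝ => Complex.Gamma (1 - s) ^ 2 * (x : ℂ) ^ ((3 * s - 2) - 1) +
      2 * Complex.Gamma (1 - s) * ((x : ℂ) ^ ((2 * s - 1) - 1) * expRem s x)) (Ioc 0 1) :=
    hI3.add hI2
  have heq : EqOn (fun x : ℝ => (x : ℂ) ^ (s - 1) * expSum s x ^ 2)
      (fun x : ℝ => Complex.Gamma (1 - s) ^ 2 * (x : ℂ) ^ ((3 * s - 2) - 1) +
        2 * Complex.Gamma (1 - s) * ((x : ℂ) ^ ((2 * s - 1) - 1) * expRem s x) +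
        (x : ℂ) ^ (s - 1) * expRem s x ^ 2) (Ioc 0 1) :=
    fun x hx => cpow_mul_expSum_sq s hx.1
  have hI : IntegrableOn (fun x : ℝ => (x : ℂ) ^ (s - 1) * expSum s x ^ 2) (Ioc 0 1) :=
    IntegrableOn.congr_fun (hI23.add hI1) heq.symm measurableSet_Ioc
  have h2 := integral_cpow_mul_sum_add (Finset.range N) (taylorCoeff s) id hw2
    ((isHolomorphicFamily_taylorRem N).integrableOn_mellin hs1 (hN.trans_lt hw2))
  have h1 := integral_cpow_mul_sum_add (Finset.range N ×ˢ Finset.range N)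
    (fun p => taylorCoeff s p.1 * taylorCoeff s p.2) (fun p => p.1 + p.2) hw1
    ((isHolomorphicFamily_sqRem N).integrableOn_mellin hs1 (hN.trans_lt hw1))
  simp only [id, ← expRem_eq_sum_add] at h2
  simp only [← expRem_sq_eq_sum_add] at h1
  rw [Gamma_mul_diagSum hs, ← Ioc_union_Ioi_eq_Ioi (zero_le_one' ℝ),
    setIntegral_union (Ioc_disjoint_Ioi le_rfl) measurableSet_Ioi hI (integrableOn_tail s),
    setIntegral_congr_fun measurableSet_Ioc heq, integral_add hI23 hI1,
    integral_add hI3 hI2, integral_const_mul, integral_const_mul, integral_cpow_Ioc hw3, h2, h1,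
    mellinExpansion]
  -- The denominators in `mellinExpansion` are kept in the shape `a * s + b` required by
  -- `div_linear`.
  have e2 : ∀ j : ℕ, 2 * s - 1 + (j : ℂ) = 2 * s + (-1 + j) := fun j => by ring
  simp only [e2, one_mul, mul_one_div, sub_eq_add_neg (3 * s)]
  ring

/-! ### Residues of the continuation -/

/-- The residue of `mellinExpansion N` at `z`. -/
noncomputable def expansionResidue (N : ℕ) (z : ℂ) : ℂ :=
  (if 3 * z + -2 = 0 then Complex.Gamma (1 - z) ^ 2 / 3 else 0) +
    2 * Complex.Gamma (1 - z) *
      ∑ j ∈ Finset.range N, (if 2 * z + (-1 + j) = 0 then taylorCoeff z j / 2 else 0) +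
    ∑ p ∈ Finset.range N ×ˢ Finset.range N,
      (if 1 * z + (p.1 + p.2 : ℕ) = 0 then taylorCoeff z p.1 * taylorCoeff z p.2 / 1 else 0)

theorem analyticAt_of_differentiableOn_re_lt_one {f : ℂ → ℂ}
    (hf : DifferentiableOn ℂ f {s | s.re < 1}) {z : ℂ} (hz : z.re < 1) : AnalyticAt ℂ f z :=
  hf.analyticAt (isOpen_re_lt_one.mem_nhds hz)

theorem IsHolomorphicFamily.analyticAt_mellin {N : ℕ} {H : ℂ → ℝ → ℂ}
    (h : IsHolomorphicFamily {s | s.re < 1} N H) {w : ℂ → ℂ} (hw : Differentiable ℂ w) {z : ℂ}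
    (hz : z.re < 1) (hwz : -(N : ℝ) < (w z).re) :
    AnalyticAt ℂ (fun s => ∫ x : ℝ in Ioc 0 1, (x : ℂ) ^ (w s - 1) * H s x) z :=
  (h.differentiableOn_mellin isOpen_re_lt_one hw).analyticAt
    ((isOpen_re_lt_one.inter (isOpen_lt continuous_const
      (Complex.continuous_re.comp hw.continuous))).mem_nhds ⟨hz, hwz⟩)

theorem hasSimpleResidueAt_mellinExpansion {N : ℕ} {z : ℂ} (hz : z.re < 1)
    (h1 : -(N : ℝ) < z.re) (h2 : -(N : ℝ) < (2 * z - 1).re) :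
    HasSimpleResidueAt (mellinExpansion N) (expansionResidue N z) z := by
  have hG : AnalyticAt ℂ (fun s => Complex.Gamma (1 - s)) z :=
    analyticAt_of_differentiableOn_re_lt_one
      (fun s hs => (differentiableAt_Gamma_one_sub hs).differentiableWithinAt) hz
  have ha : ∀ j, AnalyticAt ℂ (fun s => taylorCoeff s j) z := fun j =>
    analyticAt_of_differentiableOn_re_lt_one (differentiableOn_taylorCoeff j) hz
  have hT := HasSimpleResidueAt.of_analyticAt (differentiable_tail.analyticAt z)
  have hA := HasSimpleResidueAt.div_linear (hG.pow 2) three_ne_zero (-2)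
  have hB := (HasSimpleResidueAt.sum (Finset.range N) fun j _ =>
    HasSimpleResidueAt.div_linear (ha j) two_ne_zero (-1 + (j : ℂ))).add
    (HasSimpleResidueAt.of_analyticAt ((isHolomorphicFamily_taylorRem N).analyticAt_mellin
      (w := fun s => 2 * s - 1) (by fun_prop) hz h2))
  have hC := (HasSimpleResidueAt.sum (Finset.range N ×ˢ Finset.range N) fun p _ =>
    HasSimpleResidueAt.div_linear ((ha p.1).mul (ha p.2)) one_ne_zero ((p.1 + p.2 : ℕ) : ℂ)).add
    (HasSimpleResidueAt.of_analyticAt ((isHolomorphicFamily_sqRem N).analyticAt_mellin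
      (w := fun s => s) (by fun_prop) hz h1))
  have h := ((hT.add hA).add (hB.mul_analytic (analyticAt_const.mul hG (f := fun _ => 2)))).add hC
  simp only [zero_add, add_zero] at h
  exact h

/-- The continuation of the diagonal double series to the half plane `-M < re s`. -/
noncomputable def halfPlaneExt (M : ℕ) (s : ℂ) : ℂ :=
  if 2 / 3 < s.re then diagSum s else (Complex.Gamma s)⁻¹ * mellinExpansion (2 * M + 1) s

theorem halfPlaneExt_eventuallyEq_diagSum (M : ℕ) {z : ℂ} (hz : 2 / 3 < z.re) :
    halfPlaneExt M =ᶠ[𝓝 z] diagSum := by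
  filter_upwards [isOpen_two_thirds_lt_re.mem_nhds hz] with s hs
  exact if_pos hs

theorem hasSimpleResidueAt_halfPlaneExt_of_lt (M : ℕ) {z : ℂ} (hz : 2 / 3 < z.re) :
    HasSimpleResidueAt (halfPlaneExt M) 0 z :=
  (HasSimpleResidueAt.of_analyticAt (analyticAt_diagSum hz)).congr
    ((halfPlaneExt_eventuallyEq_diagSum M hz).filter_mono nhdsWithin_le_nhds)

theorem hasSimpleResidueAt_halfPlaneExt {M : ℕ} {z : ℂ} (hz : z.re < 1) (hM : -(M : ℝ) < z.re) :
    HasSimpleResidueAt (halfPlaneExt M)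
      ((Complex.Gamma z)⁻¹ * expansionResidue (2 * M + 1) z) z := by
  have hM0 : (0 : ℝ) ≤ M := M.cast_nonneg
  -- From -M < Re z follows -(2M+1) < Re(2z-1), which fixes the truncation order `2 * M + 1`.
  have h := (hasSimpleResidueAt_mellinExpansion (N := 2 * M + 1) hz
    (by push_cast; linarith) (by push_cast; simp; linarith)).mul_analytic
      (Complex.differentiable_one_div_Gamma.analyticAt z)
  refine h.congr ?_
  filter_upwards [nhdsWithin_le_nhds (isOpen_re_lt_one.mem_nhds hz)] with s hs
  rw [halfPlaneExt]
  split_ifs with hs'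
  · have hG : Complex.Gamma s ≠ 0 := Complex.Gamma_ne_zero_of_re_pos (by linarith)
    rw [← Gamma_mul_diagSum_eq_mellinExpansion _ hs' hs, inv_mul_cancel_left₀ hG]
  · rfl

theorem meromorphicOn_halfPlaneExt (M : ℕ) :
    MeromorphicOn (halfPlaneExt M) {s | -(M : ℝ) < s.re} := by
  intro z hz
  rcases lt_or_ge (2 / 3) z.re with h | h
  · exact (hasSimpleResidueAt_halfPlaneExt_of_lt M h).meromorphicAt
  · exact (hasSimpleResidueAt_halfPlaneExt (by linarith) hz).meromorphicAt

theorem expansionResidue_ne_zero_iff {M : ℕ} {z : ℂ} (hz : z.re < 1) (hM : -(M : ℝ) < z.re) :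
    (Complex.Gamma z)⁻¹ * expansionResidue (2 * M + 1) z ≠ 0 ↔
      (z = 2 / 3 ∨ ∃ k : ℕ, z = 1 / 2 - (k : ℂ)) := by
  have hG1 : Complex.Gamma (1 - z) ≠ 0 := Complex.Gamma_ne_zero (one_sub_ne_neg_nat hz)
  by_cases hint : ∃ n : ℕ, z = -(n : ℂ)
  · obtain ⟨n, rfl⟩ := hint
    -- `Complex.Gamma` takes the value 0 at its poles, so `(Gamma z)⁻¹ = 0` there, the true value of
    -- the entire function 1/Γ.
    rw [Complex.Gamma_neg_nat_eq_zero, inv_zero, zero_mul]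
    refine ⟨fun h => absurd rfl h, ?_⟩
    rintro (h | ⟨k, h⟩)
    · have h3 : (-3 * n : ℂ) = 2 := by linear_combination 3 * h
      have h4 : (-3 * n : ℤ) = 2 := by exact_mod_cast h3
      omega
    · have h3 : (-2 * n : ℂ) = 1 - 2 * k := by linear_combination 2 * h
      have h4 : (-2 * n : ℤ) = 1 - 2 * k := by exact_mod_cast h3
      omega
  have hG : Complex.Gamma z ≠ 0 := by
    rw [Ne, Complex.Gamma_eq_zero_iff]
    exact hint
  have hC : ∑ p ∈ Finset.range (2 * M + 1) ×ˢ Finset.range (2 * M + 1),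
      (if 1 * z + (p.1 + p.2 : ℕ) = 0 then taylorCoeff z p.1 * taylorCoeff z p.2 / 1 else 0)
      = 0 := by
    refine Finset.sum_eq_zero fun p _ => if_neg fun h => hint ⟨p.1 + p.2, ?_⟩
    linear_combination h
  rw [expansionResidue, hC, add_zero, mul_ne_zero_iff, and_iff_right (inv_ne_zero hG)]
  by_cases h23 : z = 2 / 3
  · have hB : ∑ j ∈ Finset.range (2 * M + 1),
        (if 2 * z + (-1 + j) = 0 then taylorCoeff z j / 2 else 0) = 0 := by
      refine Finset.sum_eq_zero fun j _ => if_neg fun h => ?_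
      rw [h23] at h
      have h3 : (1 + 3 * j : ℂ) = 0 := by linear_combination 3 * h
      have h4 : 1 + 3 * j = 0 := by exact_mod_cast h3
      omega
    rw [hB, mul_zero, add_zero, if_pos (by rw [h23]; norm_num)]
    exact iff_of_true (div_ne_zero (pow_ne_zero 2 hG1) three_ne_zero) (Or.inl h23)
  have hA : 3 * z + -2 ≠ 0 := fun h => h23 (by linear_combination h / 3)
  rw [if_neg hA, zero_add, or_iff_right h23, mul_ne_zero_iff,
    and_iff_right (mul_ne_zero two_ne_zero hG1)]
  constructor
  · intro h
    obtain ⟨j, -, hj⟩ := Finset.exists_ne_zero_of_sum_ne_zero h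
    have hj0 : 2 * z + (-1 + j) = 0 := by
      by_contra hne
      exact hj (if_neg hne)
    obtain ⟨k, rfl | rfl⟩ := Nat.even_or_odd' j
    · refine ⟨k, ?_⟩
      push_cast at hj0
      linear_combination hj0 / 2
    -- An odd index j = 2k + 1 would put z at -k, which is excluded.
    · refine absurd ⟨k, ?_⟩ hint
      push_cast at hj0
      linear_combination hj0 / 2
  · rintro ⟨k, hk⟩
    -- The truncation reaches the index 2k responsible for this pole, since -M < 1/2 - k forces k ≤
    -- M.
    have hkM : 2 * k < 2 * M + 1 := by
      rw [hk] at hM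
      simp only [Complex.sub_re, Complex.natCast_re] at hM
      have : (k : ℝ) < M + 1 := by
        norm_num at hM
        linarith
      have : k < M + 1 := by exact_mod_cast this
      omega
    rw [Finset.sum_eq_single (2 * k)]
    · rw [if_pos (by rw [hk]; push_cast; ring), taylorCoeff]
      have hz3 : z - ((2 * k : ℕ) : ℂ) = 1 / 2 - 3 * k := by
        rw [hk]
        push_cast
        ring
      rw [hz3]
      exact div_ne_zero (div_ne_zero (mul_ne_zero (pow_ne_zero _ (neg_ne_zero.2 one_ne_zero))
        (expRemZero_half_sub_ne_zero k)) (by exact_mod_cast Nat.factorial_ne_zero _)) two_ne_zero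
    · intro j _ hj
      refine if_neg fun h => hj ?_
      rw [hk] at h
      have h3 : (j : ℂ) = 2 * k := by linear_combination h
      exact_mod_cast h3
    · intro h
      exact absurd (Finset.mem_range.2 hkM) h

/-! ### Meromorphic continuation -/

theorem exists_isDiagonalTornheimZeta : ∃ F : ℂ → ℂ, IsDiagonalTornheimZeta F := by
  have h1 : (2 / 3 : ℝ) < (1 : ℂ).re := by norm_num
  obtain ⟨G, hG⟩ := exists_meromorphic_of_halfPlanes (F := halfPlaneExt) (z := 1)
    meromorphicOn_halfPlaneExt (by simp) fun N =>
      ((halfPlaneExt_eventuallyEq_diagSum N h1).trans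
        (halfPlaneExt_eventuallyEq_diagSum 0 h1).symm).filter_mono nhdsWithin_le_nhds
  -- Gluing controls `G` only on punctured neighbourhoods, whereas `hasSum` needs the value at every
  -- point.
  refine ⟨fun s => if 2 / 3 < s.re then diagSum s else G s, fun s hs => ?_, fun s => ?_⟩
  · rw [mem_convergenceRegion_diag] at hs
    rw [if_pos hs]
    exact hasSum_diagSum hs
  · obtain ⟨M, hM⟩ := exists_nat_gt (-s.re)
    have hM' : -(M : ℝ) < s.re := by linarith
    refine (meromorphicOn_halfPlaneExt M s hM').congr ?_
    filter_upwards [hG M s hM'] with w hw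
    split_ifs with h
    · exact if_pos h
    · exact hw.symm

theorem IsDiagonalTornheimZeta.eq_diagSum {F : ℂ → ℂ} (hF : IsDiagonalTornheimZeta F) {s : ℂ}
    (hs : 2 / 3 < s.re) : F s = diagSum s :=
  (hF.hasSum s (mem_convergenceRegion_diag.2 hs)).unique (hasSum_diagSum hs)

theorem IsDiagonalTornheimZeta.eventuallyEq_halfPlaneExt {F : ℂ → ℂ}
    (hF : IsDiagonalTornheimZeta F) {M : ℕ} {z : ℂ} (hz : -(M : ℝ) < z.re) :
    F =ᶠ[𝓝[≠] z] halfPlaneExt M := by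
  have h1 : (2 / 3 : ℝ) < (1 : ℂ).re := by norm_num
  have hM0 : (0 : ℝ) ≤ M := M.cast_nonneg
  refine eventuallyEq_of_meromorphicOn (convex_halfSpace_re_gt _).isPreconnected
    (fun s _ => hF.meromorphic s) (meromorphicOn_halfPlaneExt M) (z := 1)
    (by simp only [mem_ofPred_eq, Complex.one_re]; linarith) hz
    (EventuallyEq.filter_mono ?_ nhdsWithin_le_nhds)
  filter_upwards [isOpen_two_thirds_lt_re.mem_nhds h1] with s hs
  rw [hF.eq_diagSum hs, halfPlaneExt, if_pos hs]

theorem IsDiagonalTornheimZeta.exists_hasSimpleResidueAt {F : ℂ → ℂ}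
    (hF : IsDiagonalTornheimZeta F) (z : ℂ) :
    ∃ r : ℂ, HasSimpleResidueAt F r z ∧
      (r ≠ 0 ↔ (z = 2 / 3 ∨ ∃ k : ℕ, z = 1 / 2 - (k : ℂ))) := by
  obtain ⟨M, hM⟩ := exists_nat_gt (-z.re)
  have hM' : -(M : ℝ) < z.re := by linarith
  have heq := hF.eventuallyEq_halfPlaneExt hM'
  rcases lt_or_ge (2 / 3) z.re with h | h
  · refine ⟨0, (hasSimpleResidueAt_halfPlaneExt_of_lt M h).congr heq,
      iff_of_false (fun h => h rfl) ?_⟩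
    rintro (rfl | ⟨k, rfl⟩)
    · norm_num at h
    · have hk : (0 : ℝ) ≤ k := k.cast_nonneg
      norm_num at h
      linarith
  · exact ⟨_, (hasSimpleResidueAt_halfPlaneExt (by linarith) hM').congr heq,
      expansionResidue_ne_zero_iff (by linarith) hM'⟩

theorem IsDiagonalTornheimZeta.isPole_iff {F : ℂ → ℂ} (hF : IsDiagonalTornheimZeta F) (z : ℂ) :
    IsPole F z ↔ (z = 2 / 3 ∨ ∃ k : ℕ, z = 1 / 2 - (k : ℂ)) := by
  obtain ⟨r, hr, hiff⟩ := hF.exists_hasSimpleResidueAt z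
  rw [← hiff]
  constructor
  · rintro ⟨-, h⟩ rfl
    exact absurd hr.meromorphicOrderAt_nonneg (not_le.2 h)
  · intro h
    refine ⟨hr.meromorphicAt, ?_⟩
    rw [hr.meromorphicOrderAt_eq h]
    decide

theorem IsDiagonalTornheimZeta.isSimplePole_of_isPole {F : ℂ → ℂ}
    (hF : IsDiagonalTornheimZeta F) {z : ℂ} (hz : IsPole F z) : IsSimplePole F z := by
  obtain ⟨r, hr, hiff⟩ := hF.exists_hasSimpleResidueAt z
  exact ⟨hr.meromorphicAt, hr.meromorphicOrderAt_eq (hiff.2 ((hF.isPole_iff z).1 hz))⟩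

/-! ### Restriction of the three variable function to the diagonal -/

theorem eq_of_mem_singularSet_diag {s : ℂ} (hs : (s, s, s) ∈ singularSet) :
    s = 2 / 3 ∨ ∃ k : ℤ, s = k / 2 := by
  rcases hs with ⟨k, -, hk⟩ | ⟨k, -, hk⟩ | h
  · exact Or.inr ⟨k, by linear_combination hk / 2⟩
  · exact Or.inr ⟨k, by linear_combination hk / 2⟩
  · exact Or.inl (by linear_combination h / 3)

theorem countable_singularSet_diag : {s : ℂ | (s, s, s) ∈ singularSet}.Countable := by
  refine ((countable_singleton (2 / 3 : ℂ)).union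
    (countable_range fun k : ℤ => (k : ℂ) / 2)).mono fun s hs => ?_
  rcases eq_of_mem_singularSet_diag hs with h | ⟨k, hk⟩
  · exact Or.inl h
  · exact Or.inr ⟨k, hk.symm⟩

theorem eventually_notMem_singularSet_diag (z : ℂ) :
    ∀ᶠ s : ℂ in 𝓝[≠] z, (s, s, s) ∉ singularSet := by
  set A : Set ℂ := {2 / 3} ∪ (fun k : ℤ => (k : ℂ) / 2) '' Icc (⌊2 * z.re⌋ - 2) (⌈2 * z.re⌉ + 2)
  have hA : A.Finite := (finite_singleton _).union ((finite_Icc _ _).image _)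
  have h1 : ∀ᶠ s : ℂ in 𝓝[≠] z, s ∉ A \ {z} :=
    nhdsWithin_le_nhds ((hA.subset sdiff_subset).isClosed.isOpen_compl.mem_nhds (by simp))
  have h2 : ∀ᶠ s : ℂ in 𝓝[≠] z, |s.re - z.re| < 1 := by
    refine eventually_nhdsWithin_of_eventually_nhds ?_
    have hc : Continuous fun s : ℂ => |s.re - z.re| := by fun_prop
    exact hc.continuousAt.eventually (eventually_lt_nhds (by simp))
  filter_upwards [h1, h2, self_mem_nhdsWithin] with s hs hs2 hsz hmem
  refine hs ⟨?_, hsz⟩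
  rcases eq_of_mem_singularSet_diag hmem with h | ⟨k, rfl⟩
  · exact Or.inl h
  · refine Or.inr ⟨k, ?_, rfl⟩
    have hre : ((k : ℂ) / 2).re = (k : ℝ) / 2 := by simp
    rw [hre, abs_lt] at hs2
    constructor
    · have : ((⌊2 * z.re⌋ - 2 : ℤ) : ℝ) ≤ k := by
        push_cast
        linarith [Int.floor_le (2 * z.re)]
      exact_mod_cast this
    · have : (k : ℝ) ≤ ((⌈2 * z.re⌉ + 2 : ℤ) : ℝ) := by
        push_cast
        linarith [Int.le_ceil (2 * z.re)]
      exact_mod_cast this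

theorem IsTornheimZeta.analyticAt_diag {T : ℂ × ℂ × ℂ → ℂ} (hT : IsTornheimZeta T) {s : ℂ}
    (hs : (s, s, s) ∉ singularSet) : AnalyticAt ℂ (fun s : ℂ => T (s, s, s)) s :=
  (hT.analytic (s, s, s) hs).comp (f := fun s : ℂ => (s, s, s))
    (analyticAt_id.prod (analyticAt_id.prod analyticAt_id))

/-- Nothing is assumed of `T` on the hyperplanes, so meromorphy there is imported from a known
continuation `F`: the two agree off a countable set with connected complement, hence on a punctured
neighbourhood of every point. -/
theorem IsTornheimZeta.isDiagonalTornheimZeta {T : ℂ × ℂ × ℂ → ℂ} (hT : IsTornheimZeta T) :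
    IsDiagonalTornheimZeta fun s : ℂ => T (s, s, s) := by
  refine ⟨fun s hs => hT.hasSum s s s hs, fun z => ?_⟩
  obtain ⟨F, hF⟩ := exists_isDiagonalTornheimZeta
  set D : ℂ → ℂ := fun s => T (s, s, s) with hD
  set S : Set ℂ := {s | (s, s, s) ∈ singularSet} with hS
  have hconn : IsConnected Sᶜ := countable_singularSet_diag.isConnected_compl_of_one_lt_rank
    (by rw [Complex.rank_real_complex]; exact Nat.one_lt_ofNat)
  have h43 : (2 / 3 : ℝ) < (4 / 3 : ℂ).re := by norm_num
  -- `eq_of_mem_singularSet_diag` drops the condition `k ≤ 1`, so the base point is chosen to avoid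
  -- every half-integer, not only those up to 1/2.
  have hmem : (4 / 3 : ℂ) ∈ Sᶜ := by
    intro h
    rcases eq_of_mem_singularSet_diag h with h | ⟨k, hk⟩
    · norm_num at h
    · have h3 : (8 : ℂ) = 3 * k := by linear_combination 6 * hk
      have h4 : (8 : ℤ) = 3 * k := by exact_mod_cast h3
      omega
  have hlocal : D =ᶠ[𝓝[≠] (4 / 3)] F := by
    filter_upwards [nhdsWithin_le_nhds (isOpen_two_thirds_lt_re.mem_nhds h43)] with s hs
    rw [hF.eq_diagSum hs]
    exact (hT.hasSum s s s (mem_convergenceRegion_diag.2 hs)).unique (hasSum_diagSum hs)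
  have hall : ∀ w ∈ Sᶜ, D =ᶠ[𝓝[≠] w] F := fun w hw =>
    eventuallyEq_of_meromorphicOn hconn.isPreconnected
      (fun s hs => (hT.analyticAt_diag hs).meromorphicAt) (fun s _ => hF.meromorphic s) hmem hw
      hlocal
  refine (hF.meromorphic z).congr ?_
  filter_upwards [(hF.meromorphic z).eventually_analyticAt, eventually_notMem_singularSet_diag z]
    with s hsF hsS
  -- Equality on a punctured neighbourhood of `s` extends to `s` itself because both functions are
  -- continuous there.
  exact tendsto_nhds_unique_of_eventuallyEq
    (hsF.continuousAt.tendsto.mono_left (nhdsWithin_le_nhds (s := {s}ᶜ)))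
    ((hT.analyticAt_diag hsS).continuousAt.tendsto.mono_left nhdsWithin_le_nhds) (hall s hsS).symm

end Tornheim

theorem corollary3 :
    (∃ F : ℂ → ℂ, Tornheim.IsDiagonalTornheimZeta F) ∧
    (∀ T : ℂ × ℂ × ℂ → ℂ, Tornheim.IsTornheimZeta T →
      Tornheim.IsDiagonalTornheimZeta (fun s : ℂ => T (s, s, s))) ∧
    (∀ F : ℂ → ℂ, Tornheim.IsDiagonalTornheimZeta F →
      (∀ z : ℂ, Tornheim.IsPole F z → Tornheim.IsSimplePole F z) ∧
      (∀ z : ℂ, Tornheim.IsPole F z ↔ (z = 2 / 3 ∨ ∃ k : ℕ, z = 1 / 2 - (k : ℂ)))) :=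
  ⟨Tornheim.exists_isDiagonalTornheimZeta,
    fun _ hT => hT.isDiagonalTornheimZeta,
    fun _ hF => ⟨fun _ hz => hF.isSimplePole_of_isPole hz, fun z => hF.isPole_iff z⟩⟩
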